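/- Let $n\ge 2$ agents hold differentiable functions $f_1,\dots,f_n:\mathbb{R}^p\to\mathbb{R}$ and let $f=\frac1n\sum_{i=1}^n f_i$. Assume that (i) every $f_i$ is bounded below and $\|\nabla f_i(x)-\nabla f_i(x')\|\le L\|x-x'\|$ for all $x,x'$, with $L>0$; (ii) for some $\mu>0$, $f(y)\ge f(x)+\langle\nabla f(x),y-x\rangle+\frac{\mu}{2}\|y-x\|^2$ for all $x,y$; (iii) agent $i$ has stochastic gradients $g_i(x,\xi_i)$, $\xi_i\sim\mathcal{D}_i$, with $\mathbb{E}\,g_i(x,\xi_i)=\nabla f_i(x)$ and $\mathbb{E}\|g_i(x,\xi_i)-\nabla f_i(x)\|^2\le\sigma^2$ for all $x$, with $\sigma>0$. Let $x^*$ be the minimizer of $f$, let $\kappa=L/\mu$, and let $B\ge2$ be an integer. Fill a $B$-ary tree with the nodes $1,\dots,n$ layer by layer: node $1$ is the root, and the children of node $j$ are the nodes $Bj+2-B,\dots,Bj+1$ that are at most $n$. Let $d$ be its depth, that is, the integer with $\frac{B^d-1}{B-1}<n\le\frac{B^{d+1}-1}{B-1}$. Let $\mathcal{R}\in\{0,1\}^{n\times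 n}$ have $\mathcal{R}_{ij}=1$ exactly when $j$ is the parent of $i$ or $i=j=1$, and let $\mathcal{C}=\mathcal{R}^\top$. Given $x^{(0)}\in\mathbb{R}^p$ and a stepsize $\gamma$, the B-ary Tree Push-Pull method generates matrices $X^{(t)},Y^{(t)}\in\mathbb{R}^{n\times p}$, whose $i$-th rows $x_i^{(t)},y_i^{(t)}$ belong to agent $i$, by $$X^{(t+1)}=\mathcal{R}\,(X^{(t)}-\gamma Y^{(t)}),\qquad Y^{(t+1)}=\mathcal{C}\,Y^{(t)}+G^{(t+1)}-G^{(t)},$$ where $x_i^{(0)}=x^{(0)}$ for all $i$, $Y^{(0)}=G^{(0)}$, and the $i$-th row of $G^{(t)}$ is $g_i(x_i^{(t)},\xi_i^{(t)})$, all samples $\xi_i^{(t)}\sim\mathcal{D}_i$ being independent over agents $i$ and iterations $t$. Let $T\ge 2d$ be an integer and $$\gamma=\min\left\{\frac{1}{100nd^2\kappa L},\ \frac{16\log(n(T+1)^2)}{n(T+1)\mu}\right\}.$$ Then $$\mathbb{E}\|x_1^{(T)}-x^*\|^2\le\frac{2240\,\sigma^2\log(n(T+1)^2)}{n(T+1)\mu^2}+\frac{26880000\,d^6\kappa^2\sigma^2\big(\log(n(T+1)^2)\big)^2}{n(T+1)^2\mu^2}+\max\left\{e^{-\frac{T}{800d^2\kappa^2}},\frac{40}{n(T+1)^2}\right\}\left(\|x^{(0)}-x^*\|^2+\frac{1}{nL^2}\sum_{i=1}^n\|\nabla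 f_i(x^{(0)})\|^2\right).$$ Consequently the transient time is $\tilde{O}(1)$, polylogarithmic in $n$: for every $V\ge0$ there are constants $K$ and $q$, depending only on $L,\mu,\sigma$ and $V$, such that for all $n\ge2$, $B\ge2$ (with $d$ the depth of the corresponding tree) and all $T\ge K(\log n)^q$, one has $T\ge 2d$, and the sum of the last two terms of the bound, with the last bracket replaced by $V$, is at most the first term. -/

import Mathlib

open MeasureTheory ProbabilityTheory

noncomputable section

namespace BTPP

/-- The space `ℝ^p` of decision variables, with the Euclidean norm. -/
abbrev Vec (p : ℕ) : Type := EuclideanSpace ℝ (Fin p)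

/-! ### The two trees -/

/-- `d` is the depth of the `B`-ary tree with `n` nodes filled layer by layer (the distance of the
last layer from the root): the layers `0, …, d - 1`, of sizes `1, B, …, B ^ (d - 1)`, do not suffice
for `n` nodes, while the layers `0, …, d` do. For `2 ≤ B` this reads
`(B ^ d - 1) / (B - 1) < n ≤ (B ^ (d + 1) - 1) / (B - 1)`. -/
def IsTreeDepth (B n d : ℕ) : Prop :=
  ∑ k ∈ Finset.range d, B ^ k < n ∧ n ≤ ∑ k ∈ Finset.range (d + 1), B ^ k

/-- The pull matrix `R` of the `B`-ary tree. Nodes are numbered from `0`, layer by layer, so the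
root is `0` and the children of node `j` are `B * j + 1, …, B * j + B` (as far as these are `< n`).
`R i j = 1` if `j` is the parent of `i`, or if `i = j` is the root; otherwise `R i j = 0`. -/
def pullMatrix (B n : ℕ) : Matrix (Fin n) (Fin n) ℝ := fun i j =>
  if (B * j.val + 1 ≤ i.val ∧ i.val ≤ B * j.val + B) ∨ (i.val = 0 ∧ j.val = 0) then 1 else 0

/-- The push matrix `C` is the transpose of the pull matrix. -/
def pushMatrix (B n : ℕ) : Matrix (Fin n) (Fin n) ℝ := (pullMatrix B n).transpose

/-! ### The algorithm -/

/-- The iterates `(X^(t), Y^(t))` of B-ary Tree Push-Pull with stepsize `γ`, stochastic gradients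
`g i`, common initial point `x0`, along the samples `ξ t i` (agent `i`, iteration `t`):
`X^(0) = (x0, …, x0)`, `Y^(0) = G^(0)`, `X^(t+1) = R (X^(t) - γ Y^(t))`,
`Y^(t+1) = C Y^(t) + G^(t+1) - G^(t)`, where `G^(t)` has the rows `g i (x_i^(t)) (ξ t i)`. -/
def iterates {p n : ℕ} {S : Fin n → Type*} (B : ℕ) (γ : ℝ)
    (g : (i : Fin n) → Vec p → S i → Vec p) (x0 : Vec p) (ξ : ℕ → (i : Fin n) → S i) :
    ℕ → (Fin n → Vec p) × (Fin n → Vec p)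
  | 0 => (fun _ => x0, fun i => g i x0 (ξ 0 i))
  | t + 1 =>
    let X := (iterates B γ g x0 ξ t).1
    let Y := (iterates B γ g x0 ξ t).2
    let X' : Fin n → Vec p := fun i => ∑ j, pullMatrix B n i j • (X j - γ • Y j)
    (X', fun i => ∑ j, pushMatrix B n i j • Y j + g i (X' i) (ξ (t + 1) i) - g i (X i) (ξ t i))

/-- The copy `x_i^(t)` of the decision variable held by agent `i` at iteration `t`. -/
def agentIterate {p n : ℕ} {S : Fin n → Type*} (B : ℕ) (γ : ℝ)
    (g : (i : Fin n) → Vec p → S i → Vec p) (x0 : Vec p) (ξ : ℕ → (i : Fin n) → S i)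
    (t : ℕ) (i : Fin n) : Vec p :=
  (iterates B γ g x0 ξ t).1 i

/-! ### The objective and the assumptions -/

/-- The global objective `f = (1/n) ∑ f_i`. -/
def avgObjective {p n : ℕ} (f : Fin n → Vec p → ℝ) (x : Vec p) : ℝ :=
  (1 / (n : ℝ)) * ∑ i, f i x

/-- The squared Frobenius norm `‖∇F(X)‖_F²` of the matrix with the rows `∇f_i(x_i)`. -/
def gradFrobeniusSq {p n : ℕ} (f : Fin n → Vec p → ℝ) (X : Fin n → Vec p) : ℝ :=
  ∑ i, ‖gradient (f i) (X i)‖ ^ 2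

/-- Each `g i x ξ_i`, `ξ_i ∼ D i`, is an unbiased estimator of `∇f_i(x)` with variance at most
`σ²`, for every point `x`. -/
structure UnbiasedBoundedVariance {p n : ℕ} {S : Fin n → Type*} [∀ i, MeasurableSpace (S i)]
    (f : Fin n → Vec p → ℝ) (g : (i : Fin n) → Vec p → S i → Vec p)
    (D : (i : Fin n) → Measure (S i)) (σ : ℝ) : Prop where
  measurable : ∀ i, Measurable (fun q : Vec p × S i => g i q.1 q.2)
  integrable : ∀ i x, Integrable (fun s => g i x s) (D i)
  unbiased : ∀ i x, ∫ s, g i x s ∂(D i) = gradient (f i) x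
  integrable_sq : ∀ i x, Integrable (fun s => ‖g i x s - gradient (f i) x‖ ^ 2) (D i)
  variance_le : ∀ i x, ∫ s, ‖g i x s - gradient (f i) x‖ ^ 2 ∂(D i) ≤ σ ^ 2

/-- Agent `i` draws `ξ t i` from `D i` at iteration `t`, all draws (over agents and iterations)
being independent. -/
structure IndependentSampling {n : ℕ} {S : Fin n → Type*} [∀ i, MeasurableSpace (S i)]
    {Ω : Type*} [MeasurableSpace Ω] (P : Measure Ω) (D : (i : Fin n) → Measure (S i))
    (ξ : ℕ → (i : Fin n) → Ω → S i) : Prop where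
  measurable : ∀ t i, Measurable (ξ t i)
  law : ∀ t i, P.map (ξ t i) = D i
  indep : iIndepFun (β := fun k : ℕ × Fin n => S k.2) (fun k : ℕ × Fin n => ξ k.1 k.2) P

/-- Each `f i` is lower bounded and differentiable, with `L`-Lipschitz gradient. -/
structure SmoothBelow {p n : ℕ} (f : Fin n → Vec p → ℝ) (L : ℝ) : Prop where
  bddBelow : ∀ i, BddBelow (Set.range (f i))
  differentiable : ∀ i, Differentiable ℝ (f i)
  lipschitz : ∀ i x x', ‖gradient (f i) x - gradient (f i) x'‖ ≤ L * ‖x - x'‖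

/-- `μ`-strong convexity of a (differentiable) function, in gradient form. -/
def GradStronglyConvex {p : ℕ} (F : Vec p → ℝ) (μ : ℝ) : Prop :=
  ∀ x y, F x + inner ℝ (gradient F x) (y - x) + μ / 2 * ‖y - x‖ ^ 2 ≤ F y

/-! ### The stepsize and the three terms of the bound -/

/-- `γ = min {1 / (100 n d² κ L), 16 log(n (T+1)²) / (n (T+1) μ)}` with `κ = L / μ`. -/
def stepsize (L μ : ℝ) (n d T : ℕ) : ℝ :=
  min (1 / (100 * n * d ^ 2 * (L / μ) * L))
    (16 * Real.log (n * (T + 1) ^ 2) / (n * (T + 1) * μ))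

/-- The leading term `2240 σ² log(n (T+1)²) / (n (T+1) μ²)`. -/
def leadingTerm (σ μ : ℝ) (n T : ℕ) : ℝ :=
  2240 * σ ^ 2 * Real.log (n * (T + 1) ^ 2) / (n * (T + 1) * μ ^ 2)

/-- The term `26880000 d⁶ κ² σ² (log(n (T+1)²))² / (n (T+1)² μ²)` with `κ = L / μ`. -/
def higherOrderTerm (σ L μ : ℝ) (n d T : ℕ) : ℝ :=
  26880000 * d ^ 6 * (L / μ) ^ 2 * σ ^ 2 * Real.log (n * (T + 1) ^ 2) ^ 2
    / (n * (T + 1) ^ 2 * μ ^ 2)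

/-- The factor `max {exp(-T / (800 d² κ²)), 40 / (n (T+1)²)}` with `κ = L / μ`. -/
def initialFactor (L μ : ℝ) (n d T : ℕ) : ℝ :=
  max (Real.exp (-(T / (800 * d ^ 2 * (L / μ) ^ 2)))) (40 / (n * (T + 1) ^ 2))

end BTPP

end

/-! Give every event an arrival clock: what node `j` does at iteration `t` concerns the root at time
`t + dep j`, when its message gets there. In this clock gradient tracking is exact (`tracker_eq`):
at time `t` the root holds the sum over `j` of the stochastic gradients drawn by `j` at iteration `t
- dep j`, and every other node the difference of two consecutive such sums over its subtree. So the
root performs SGD on the sum of the `f i` with delays at most `d`.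

Randomness disappears by working in the Hilbert space L²(Ω; ℝ^p). The iterate of node `i` at
iteration `t` depends only on samples with a strictly earlier clock, so noises arriving together are
orthogonal to one another, to the root's iterate and to the true gradients arriving with them.
`TreePushPull` records this, and the rest of the error analysis is deterministic. Orthogonality
makes the squared norm of the total noise at most n σ² instead of n² σ², which is the source of the
1/n in the leading term.

Let q = γnμ, a = γnL, ν = γ√n σ; the stepsize gives 100 (da)² ≤ q. One strong induction
(`root_error`) bounds the squared root error by s(t)² = `decayProfile` · R + 3ν²/q and the staleness
of the arriving iterates by E(t) = 12 d a s(t) + 7 d ν. Past errors bound the trackers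
(`tracker_bound`), trackers bound the staleness (`consensus_error`), and staleness is a small
perturbation of a contracting gradient step (`late_step`). In the first d steps the sum of arrivals
is incomplete and nothing contracts, but the growth is mild (`early_step`) and is made up for by
time 2d.

The outcome, exp(-qT/8)(…) + 3γσ²/μ, is stronger than required: the stepsize puts the noise part
below the leading term, and the higher-order term is slack. For the transient time, d ≤ (3/2) log n
turns every condition on T into a polynomial in log n (`transient_time`). -/

noncomputable section

/-! ### Rooted trees and arrival times at the root -/

/-- A rooted tree on the node set `ι`, given by its parent map (which fixes the root) and the
depth of its nodes. -/
structure ParentTree (ι : Type*) where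
  root : ι
  par : ι → ι
  dep : ι → ℕ
  par_root : par root = root
  dep_root : dep root = 0
  dep_eq : ∀ i, i ≠ root → dep i = dep (par i) + 1

namespace ParentTree

variable {ι : Type*} (𝒯 : ParentTree ι)

lemma dep_pos {i : ι} (hi : i ≠ 𝒯.root) : 1 ≤ 𝒯.dep i := by
  rw [𝒯.dep_eq i hi]; omega

lemma dep_eq_zero {i : ι} : 𝒯.dep i = 0 ↔ i = 𝒯.root := by
  refine ⟨fun h => ?_, fun h => by rw [h, 𝒯.dep_root]⟩
  by_contra hi
  have := 𝒯.dep_pos hi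
  omega

lemma dep_par (i : ι) : 𝒯.dep (𝒯.par i) = 𝒯.dep i - 1 := by
  by_cases hi : i = 𝒯.root
  · rw [hi, 𝒯.par_root, 𝒯.dep_root]
  · rw [𝒯.dep_eq i hi]; rfl

lemma dep_iterate (k : ℕ) (i : ι) : 𝒯.dep (𝒯.par^[k] i) = 𝒯.dep i - k := by
  induction k with
  | zero => rfl
  | succ k ih => rw [Function.iterate_succ_apply', dep_par, ih]; omega

/-- `j` lies in the subtree with root `a`. -/
def Below (a j : ι) : Prop := 𝒯.dep a ≤ 𝒯.dep j ∧ 𝒯.par^[𝒯.dep j - 𝒯.dep a] j = a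

lemma below_root (j : ι) : 𝒯.Below 𝒯.root j := by
  refine ⟨by rw [𝒯.dep_root]; omega, ?_⟩
  rw [← 𝒯.dep_eq_zero, dep_iterate, 𝒯.dep_root]; omega

lemma below_self (a : ι) : 𝒯.Below a a := ⟨le_rfl, by simp⟩

/-- The quantity sent by node `j` which reaches the root at time `τ`, after `dep j` steps. -/
def arrival {H : Type*} [AddCommGroup H] (g : ℕ → ι → H) (j : ι) (τ : ℕ) : H :=
  if 𝒯.dep j ≤ τ then g (τ - 𝒯.dep j) j else 0

lemma arrival_add_dep {H : Type*} [AddCommGroup H] (g : ℕ → ι → H) (j : ι) (s : ℕ) :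
    𝒯.arrival g j (s + 𝒯.dep j) = g s j := by
  simp [arrival]

lemma arrival_of_lt {H : Type*} [AddCommGroup H] (g : ℕ → ι → H) {j : ι} {τ : ℕ}
    (h : τ < 𝒯.dep j) : 𝒯.arrival g j τ = 0 := by
  rw [arrival, if_neg (by omega)]

lemma arrival_add {H : Type*} [AddCommGroup H] (g g' : ℕ → ι → H) (j : ι) (τ : ℕ) :
    𝒯.arrival (fun t i => g t i + g' t i) j τ = 𝒯.arrival g j τ + 𝒯.arrival g' j τ := by
  unfold arrival; split_ifs <;> simp

/-! ### Distance of the iterates from the root's iterate -/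

section Consensus

variable {H : Type*} [NormedAddCommGroup H] [NormedSpace ℝ H] {x y : ℕ → ι → H} {γ : ℝ}

lemma root_drift (hγ : 0 ≤ γ) (hx : ∀ t i, x (t + 1) i = x t (𝒯.par i) - γ • y t (𝒯.par i))
    {Y : ℝ} (s k : ℕ) (hY : ∀ u, s ≤ u → u < s + k → ‖y u 𝒯.root‖ ≤ Y) :
    ‖x (s + k) 𝒯.root - x s 𝒯.root‖ ≤ k * (γ * Y) := by
  induction k with
  | zero => simp
  | succ k ih =>
    have h1 := ih fun u h h' => hY u h (by omega)
    have h2 := hY (s + k) (by omega) (by omega)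
    rw [← add_assoc, hx, 𝒯.par_root]
    calc ‖x (s + k) 𝒯.root - γ • y (s + k) 𝒯.root - x s 𝒯.root‖
        = ‖(x (s + k) 𝒯.root - x s 𝒯.root) - γ • y (s + k) 𝒯.root‖ := by congr 1; abel
      _ ≤ ‖x (s + k) 𝒯.root - x s 𝒯.root‖ + ‖γ • y (s + k) 𝒯.root‖ := norm_sub_le _ _
      _ ≤ k * (γ * Y) + γ * Y := by
          rw [norm_smul, Real.norm_of_nonneg hγ]; gcongr
      _ = _ := by push_cast; ring

/-- A node's iterate stays close to the iterate of the root at the time at which the node's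
message arrives there. -/
lemma consensus_error (hγ : 0 ≤ γ) {x0 : H} (hx0 : ∀ i, x 0 i = x0)
    (hx : ∀ t i, x (t + 1) i = x t (𝒯.par i) - γ • y t (𝒯.par i))
    {Y : ℝ} (hY0 : 0 ≤ Y) (s : ℕ) (i : ι)
    (hY : ∀ u a, s + 𝒯.dep i ≤ u + 𝒯.dep a + 2 * 𝒯.dep i → u + 𝒯.dep a < s + 𝒯.dep i →
      ‖y u a‖ ≤ Y) :
    ‖x s i - x (s + 𝒯.dep i) 𝒯.root‖ ≤ 3 * 𝒯.dep i * (γ * Y) := by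
  have hγY : 0 ≤ γ * Y := mul_nonneg hγ hY0
  induction s generalizing i with
  | zero =>
    have h := 𝒯.root_drift hγ hx (Y := Y) 0 (𝒯.dep i) fun u _ hu =>
      hY u 𝒯.root (by omega) (by rw [𝒯.dep_root]; omega)
    rw [hx0] at h ⊢
    rw [norm_sub_rev]
    refine h.trans ?_
    have : (0 : ℝ) ≤ 𝒯.dep i * (γ * Y) := by positivity
    linarith
  | succ s ih =>
    by_cases hi : i = 𝒯.root
    · subst hi
      simp [𝒯.dep_root]
    · have hd := 𝒯.dep_eq i hi
      -- The clock of `(s, j)` is two less than that of `(s + 1, i)`. Each level thus costs one step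
      -- of `j` and two steps of the root, which gives the factor 3 and the window of length `2 *
      -- dep i`.
      set j := 𝒯.par i with hj
      have h1 := ih j fun u a h h' => hY u a (by omega) (by omega)
      have h2 : ‖y s j‖ ≤ Y := hY s j (by omega) (by omega)
      have h3 := 𝒯.root_drift hγ hx (Y := Y) (s + 𝒯.dep j) 2 fun u hu hu' =>
        hY u 𝒯.root (by rw [𝒯.dep_root]; omega) (by rw [𝒯.dep_root]; omega)
      rw [hx, ← hj, show s + 1 + 𝒯.dep i = s + 𝒯.dep j + 2 by omega, hd]
      calc ‖x s j - γ • y s j - x (s + 𝒯.dep j + 2) 𝒯.root‖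
          = ‖(x s j - x (s + 𝒯.dep j) 𝒯.root) - γ • y s j
              - (x (s + 𝒯.dep j + 2) 𝒯.root - x (s + 𝒯.dep j) 𝒯.root)‖ := by congr 1; abel
        _ ≤ ‖x s j - x (s + 𝒯.dep j) 𝒯.root‖ + ‖γ • y s j‖
              + ‖x (s + 𝒯.dep j + 2) 𝒯.root - x (s + 𝒯.dep j) 𝒯.root‖ :=
            (norm_sub_le _ _).trans (add_le_add (norm_sub_le _ _) le_rfl)
        _ ≤ 3 * 𝒯.dep j * (γ * Y) + γ * Y + (2 : ℕ) * (γ * Y) := by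
            rw [norm_smul, Real.norm_of_nonneg hγ]; gcongr
        _ = _ := by push_cast; ring

end Consensus

/-! ### Subtrees and gradient tracking -/

variable [Fintype ι]

open Classical in
/-- The nodes of the subtree with root `a`. -/
def sub (a : ι) : Finset ι := Finset.univ.filter (𝒯.Below a)

lemma mem_sub {a j : ι} : j ∈ 𝒯.sub a ↔ 𝒯.Below a j := by simp [sub]

lemma sub_root : 𝒯.sub 𝒯.root = Finset.univ := by
  ext j; simp [mem_sub, below_root]

variable [DecidableEq ι]

/-- The children of `a`. -/
def children (a : ι) : Finset ι := Finset.univ.filter (fun c => 𝒯.par c = a ∧ c ≠ 𝒯.root)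

lemma mem_children {a c : ι} : c ∈ 𝒯.children a ↔ 𝒯.par c = a ∧ c ≠ 𝒯.root := by simp [children]

lemma dep_of_mem_children {a c : ι} (h : c ∈ 𝒯.children a) : 𝒯.dep c = 𝒯.dep a + 1 := by
  rw [mem_children] at h
  rw [𝒯.dep_eq c h.2, h.1]

/-- A proper descendant `j` of `a` lies below exactly one child of `a`, its ancestor `par^[dep j -
dep a - 1] j`; the fibres of this map are the subtrees of the children. -/
lemma sum_children_sub {H : Type*} [AddCommGroup H] (a : ι) (v : ι → H) :
    ∑ c ∈ 𝒯.children a, ∑ j ∈ 𝒯.sub c, v j + v a = ∑ j ∈ 𝒯.sub a, v j := by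
  have hmap : ∀ j ∈ (𝒯.sub a).erase a, 𝒯.par^[𝒯.dep j - 𝒯.dep a - 1] j ∈ 𝒯.children a := by
    intro j hj
    rw [Finset.mem_erase, mem_sub] at hj
    obtain ⟨hja, hle, hit⟩ := hj
    have hlt : 𝒯.dep a < 𝒯.dep j := by
      rcases hle.lt_or_eq with h | h
      · exact h
      · rw [h, Nat.sub_self] at hit
        exact absurd hit hja
    rw [mem_children]
    constructor
    · rw [← Function.iterate_succ_apply' 𝒯.par]
      rwa [show (𝒯.dep j - 𝒯.dep a - 1).succ = 𝒯.dep j - 𝒯.dep a by omega]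
    · rw [ne_eq, ← 𝒯.dep_eq_zero, dep_iterate]; omega
  have hfib : ∀ c ∈ 𝒯.children a,
      ((𝒯.sub a).erase a).filter (fun j => 𝒯.par^[𝒯.dep j - 𝒯.dep a - 1] j = c) = 𝒯.sub c := by
    intro c hc
    have hdc := 𝒯.dep_of_mem_children hc
    rw [mem_children] at hc
    ext j
    rw [Finset.mem_filter, Finset.mem_erase, mem_sub, mem_sub]
    constructor
    · rintro ⟨⟨hja, hle, hit⟩, h⟩
      have hlt : 𝒯.dep a < 𝒯.dep j := by
        rcases hle.lt_or_eq with h | h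
        · exact h
        · rw [h, Nat.sub_self] at hit
          exact absurd hit hja
      refine ⟨by omega, ?_⟩
      rwa [hdc, show 𝒯.dep j - (𝒯.dep a + 1) = 𝒯.dep j - 𝒯.dep a - 1 by omega]
    · rintro ⟨hle, hit⟩
      refine ⟨⟨?_, by omega, ?_⟩, ?_⟩
      · rintro rfl; omega
      · rw [show 𝒯.dep j - 𝒯.dep a = (𝒯.dep j - 𝒯.dep c).succ by omega,
          Function.iterate_succ_apply', hit, hc.1]
      · rwa [show 𝒯.dep j - 𝒯.dep a - 1 = 𝒯.dep j - 𝒯.dep c by omega]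
  rw [← Finset.sum_erase_add _ _ (𝒯.mem_sub.2 (𝒯.below_self a)),
    ← Finset.sum_fiberwise_of_maps_to hmap v]
  congr 1
  exact Finset.sum_congr rfl fun c hc => by rw [hfib c hc]

/-- The extra term is the self-loop: the root is its own parent without being its own child. -/
lemma sum_par_eq {H : Type*} [AddCommGroup H] (a : ι) (v : ι → H) :
    ∑ c with 𝒯.par c = a, v c = ∑ c ∈ 𝒯.children a, v c + (if a = 𝒯.root then v a else 0) := by
  by_cases ha : a = 𝒯.root
  · subst ha
    rw [if_pos rfl, ← Finset.sum_erase_add _ _ (show 𝒯.root ∈ Finset.univ.filter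
      (fun c => 𝒯.par c = 𝒯.root) by simp [𝒯.par_root])]
    congr 1
    refine Finset.sum_congr ?_ fun _ _ => rfl
    ext c
    simp [mem_children, and_comm]
  · rw [if_neg ha, add_zero]
    refine Finset.sum_congr ?_ fun _ _ => rfl
    ext c
    simp only [Finset.mem_filter, Finset.mem_univ, true_and, mem_children]
    refine ⟨fun h => ⟨h, ?_⟩, fun h => h.1⟩
    rintro rfl
    exact ha (by rw [← h, 𝒯.par_root])

/-- Push-sum gradient tracking on a tree: what the root holds is the sum of the arrivals, and
every other node holds the difference of two consecutive sums of arrivals over its subtree. -/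
lemma tracker_eq {H : Type*} [AddCommGroup H] {y g : ℕ → ι → H}
    (hy0 : ∀ i, y 0 i = g 0 i)
    (hy : ∀ t i, y (t + 1) i = ∑ c with 𝒯.par c = i, y t c + g (t + 1) i - g t i) (s : ℕ) (a : ι) :
    y s a = ∑ j ∈ 𝒯.sub a, (𝒯.arrival g j (s + 𝒯.dep a) -
      if a = 𝒯.root then 0 else 𝒯.arrival g j (s + 𝒯.dep a - 1)) := by
  induction s generalizing a with
  | zero =>
    -- At clock `dep a` only `a` itself has arrived; the rest of its subtree is deeper.
    rw [hy0, Finset.sum_eq_single_of_mem a (𝒯.mem_sub.2 (𝒯.below_self a))]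
    · rw [𝒯.arrival_add_dep]
      split_ifs with ha
      · simp
      · rw [𝒯.arrival_of_lt _ (by have := 𝒯.dep_pos ha; omega), sub_zero]
    · intro j hj hja
      rw [mem_sub] at hj
      have hlt : 𝒯.dep a < 𝒯.dep j := by
        rcases hj.1.lt_or_eq with h | h
        · exact h
        · have h2 := hj.2
          rw [h, Nat.sub_self] at h2
          exact absurd h2 hja
      rw [𝒯.arrival_of_lt _ (by omega), 𝒯.arrival_of_lt _ (by omega)]
      simp
  | succ s ih =>
    -- All children report the same two clock times, so their differences add up over the subtree
    -- without `a`; the new gradient difference of `a` supplies the missing node. At the root the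
    -- self-loop restores the previous total.
    have hch : ∀ c ∈ 𝒯.children a, y s c = ∑ j ∈ 𝒯.sub c,
        (𝒯.arrival g j (s + 1 + 𝒯.dep a) - 𝒯.arrival g j (s + 𝒯.dep a)) := by
      intro c hc
      have hdc := 𝒯.dep_of_mem_children hc
      rw [mem_children] at hc
      rw [ih c]
      refine Finset.sum_congr rfl fun j _ => ?_
      rw [if_neg hc.2, hdc, show s + (𝒯.dep a + 1) = s + 1 + 𝒯.dep a by omega,
        show s + 1 + 𝒯.dep a - 1 = s + 𝒯.dep a by omega]
    rw [hy, sum_par_eq, Finset.sum_congr rfl hch, ← 𝒯.arrival_add_dep g a (s + 1),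
      ← 𝒯.arrival_add_dep g a s]
    have key := 𝒯.sum_children_sub a
      (fun j => 𝒯.arrival g j (s + 1 + 𝒯.dep a) - 𝒯.arrival g j (s + 𝒯.dep a))
    rw [show s + 1 + 𝒯.dep a - 1 = s + 𝒯.dep a by omega]
    by_cases ha : a = 𝒯.root
    · rw [if_pos ha, ih a]
      simp only [if_pos ha, sub_zero]
      rw [Finset.sum_sub_distrib] at key
      rw [show ∑ j ∈ 𝒯.sub a, 𝒯.arrival g j (s + 1 + 𝒯.dep a) =
        ∑ j ∈ 𝒯.sub a, 𝒯.arrival g j (s + 1 + 𝒯.dep a) -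
        ∑ j ∈ 𝒯.sub a, 𝒯.arrival g j (s + 𝒯.dep a) + ∑ j ∈ 𝒯.sub a, 𝒯.arrival g j (s + 𝒯.dep a)
        by abel, ← key]
      abel
    · simp only [if_neg ha]
      rw [← key]
      abel

end ParentTree

/-! ### One-step estimates in a Hilbert space -/

lemma norm_sub_sq_le_young {H : Type*} [NormedAddCommGroup H] [InnerProductSpace ℝ H]
    {b : ℝ} (hb : 0 < b) (u v : H) :
    ‖u - v‖ ^ 2 ≤ (1 + b) * ‖u‖ ^ 2 + (1 + 1 / b) * ‖v‖ ^ 2 := by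
  have h : ‖u - v‖ ^ 2 ≤ (‖u‖ + ‖v‖) ^ 2 := by gcongr; exact norm_sub_le _ _
  have h2 : 0 ≤ (b * ‖u‖ - ‖v‖) ^ 2 / b := by positivity
  have h3 : (b * ‖u‖ - ‖v‖) ^ 2 / b = b * ‖u‖ ^ 2 - 2 * ‖u‖ * ‖v‖ + 1 / b * ‖v‖ ^ 2 := by
    field_simp
    ring
  nlinarith

/-- The Push-Pull recursion on a tree, with vector fields `F i` perturbed by noise `N t i`, in a
Hilbert space in which noises arriving at the root at the same time are orthogonal to each other
and to everything the root's iterate and the unperturbed arrivals depend on. -/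
structure TreePushPull {ι : Type*} [Fintype ι] [DecidableEq ι] (𝒯 : ParentTree ι)
    {H : Type*} [NormedAddCommGroup H] [InnerProductSpace ℝ H]
    (γ L μ σ : ℝ) (d : ℕ) (F : ι → H → H) (N x y : ℕ → ι → H) (x0 xs : H) : Prop where
  dep_le : ∀ i, 𝒯.dep i ≤ d
  x_zero : ∀ i, x 0 i = x0
  x_succ : ∀ t i, x (t + 1) i = x t (𝒯.par i) - γ • y t (𝒯.par i)
  y_zero : ∀ i, y 0 i = F i (x 0 i) + N 0 i
  y_succ : ∀ t i, y (t + 1) i = ∑ c with 𝒯.par c = i, y t c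
    + (F i (x (t + 1) i) + N (t + 1) i) - (F i (x t i) + N t i)
  lipschitz : ∀ i z z', ‖F i z - F i z'‖ ≤ L * ‖z - z'‖
  sum_eq_zero : ∑ i, F i xs = 0
  strongly_monotone : ∀ z, Fintype.card ι * μ * ‖z - xs‖ ^ 2 ≤ inner ℝ (∑ i, F i z) (z - xs)
  noise_sq_le : ∀ t i, ‖N t i‖ ^ 2 ≤ σ ^ 2
  noise_orthogonal : ∀ τ i j, i ≠ j → inner ℝ (𝒯.arrival N i τ) (𝒯.arrival N j τ) = 0
  noise_orthogonal_root : ∀ τ j, inner ℝ (𝒯.arrival N j τ) (x τ 𝒯.root - xs) = 0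
  noise_orthogonal_field : ∀ τ j i,
    inner ℝ (𝒯.arrival N j τ) (𝒯.arrival (fun t i => F i (x t i)) i τ) = 0

namespace TreePushPull

variable {ι : Type*} [Fintype ι] [DecidableEq ι] {𝒯 : ParentTree ι}
  {H : Type*} [NormedAddCommGroup H] [InnerProductSpace ℝ H]
  {γ L μ σ : ℝ} {d : ℕ} {F : ι → H → H} {N x y : ℕ → ι → H} {x0 xs : H}

lemma norm_arrival_noise_sq (h : TreePushPull 𝒯 γ L μ σ d F N x y x0 xs) (j : ι) (τ : ℕ) :
    ‖𝒯.arrival N j τ‖ ^ 2 ≤ σ ^ 2 := by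
  unfold ParentTree.arrival
  split_ifs
  · exact h.noise_sq_le _ _
  · simpa using sq_nonneg σ

/-- Cross terms vanish by orthogonality, so the squares add up and the bound is linear in the number
of nodes. -/
lemma norm_sum_noise_sq (h : TreePushPull 𝒯 γ L μ σ d F N x y x0 xs) (S : Finset ι) (τ : ℕ) :
    ‖∑ j ∈ S, 𝒯.arrival N j τ‖ ^ 2 ≤ Fintype.card ι * σ ^ 2 := by
  have h1 : ‖∑ j ∈ S, 𝒯.arrival N j τ‖ ^ 2 = ∑ j ∈ S, ‖𝒯.arrival N j τ‖ ^ 2 := by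
    rw [← real_inner_self_eq_norm_sq, sum_inner]
    refine Finset.sum_congr rfl fun i hi => ?_
    rw [inner_sum, Finset.sum_eq_single_of_mem i hi, real_inner_self_eq_norm_sq]
    exact fun j _ hji => h.noise_orthogonal τ i j hji.symm
  rw [h1]
  calc ∑ j ∈ S, ‖𝒯.arrival N j τ‖ ^ 2 ≤ ∑ _j ∈ S, σ ^ 2 :=
        Finset.sum_le_sum fun j _ => h.norm_arrival_noise_sq j τ
    _ = S.card * σ ^ 2 := by rw [Finset.sum_const, nsmul_eq_mul]
    _ ≤ _ := by
        gcongr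
        exact Finset.card_le_univ S

lemma norm_sum_noise (h : TreePushPull 𝒯 γ L μ σ d F N x y x0 xs) (hσ : 0 ≤ σ)
    (S : Finset ι) (τ : ℕ) :
    ‖∑ j ∈ S, 𝒯.arrival N j τ‖ ≤ √(Fintype.card ι) * σ := by
  refine abs_le_of_sq_le_sq' ?_ (by positivity) |>.2
  rw [mul_pow, Real.sq_sqrt (by positivity)]
  exact h.norm_sum_noise_sq S τ

lemma norm_sum_field_sub (h : TreePushPull 𝒯 γ L μ σ d F N x y x0 xs) (hL : 0 ≤ L) (z : H)
    {U : ℝ} (hU0 : 0 ≤ U) (S : Finset ι) (τ : ℕ)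
    (hU : ∀ j, 𝒯.dep j ≤ τ → ‖x (τ - 𝒯.dep j) j - z‖ ≤ U) :
    ‖∑ j ∈ S, 𝒯.arrival (fun t i => F i (x t i) - F i z) j τ‖ ≤ Fintype.card ι * (L * U) := by
  calc ‖∑ j ∈ S, 𝒯.arrival (fun t i => F i (x t i) - F i z) j τ‖
      ≤ ∑ j ∈ S, L * U := norm_sum_le_of_le _ fun j _ => by
        unfold ParentTree.arrival
        split_ifs with hj
        · exact (h.lipschitz _ _ _).trans (by gcongr; exact hU j hj)
        · rw [norm_zero]; positivity
    _ = S.card * (L * U) := by rw [Finset.sum_const, nsmul_eq_mul]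
    _ ≤ _ := by
        gcongr
        exact Finset.card_le_univ S

/-- Each arrival splits into field deviation from `xs`, noise, and the constant `F j xs`. After
clock `d` all constants have arrived: at the root they sum to zero, elsewhere they cancel between
the two consecutive times. Hence heterogeneity of the `F j xs` is felt only at the start. -/
lemma tracker_bound (h : TreePushPull 𝒯 γ L μ σ d F N x y x0 xs) (hL : 0 ≤ L) (hσ : 0 ≤ σ)
    {U : ℝ} (hU0 : 0 ≤ U) (s : ℕ) (a : ι)
    (hU : ∀ j τ, 𝒯.dep j ≤ τ → τ ≤ s + 𝒯.dep a → s + 𝒯.dep a ≤ τ + 1 →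
      ‖x (τ - 𝒯.dep j) j - xs‖ ≤ U) :
    ‖y s a‖ ≤ 2 * (Fintype.card ι * (L * U)) + 2 * (√(Fintype.card ι) * σ)
      + if s + 𝒯.dep a ≤ d then ∑ j, ‖F j xs‖ else 0 := by
  set θ := s + 𝒯.dep a with hθ
  have hsplit : ∀ j τ, 𝒯.arrival (fun t i => F i (x t i) + N t i) j τ =
      𝒯.arrival (fun t i => F i (x t i) - F i xs) j τ + 𝒯.arrival N j τ
        + 𝒯.arrival (fun _ i => F i xs) j τ := by
    intro j τ
    unfold ParentTree.arrival
    split_ifs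
    · beta_reduce; abel
    · simp
  have hfar : ∀ j τ, d ≤ τ → 𝒯.arrival (fun _ i => F i xs) j τ = F j xs := by
    intro j τ hτ
    rw [ParentTree.arrival, if_pos ((h.dep_le j).trans hτ)]
  have hA : ∀ τ, τ ≤ θ → θ ≤ τ + 1 → ‖∑ j ∈ 𝒯.sub a,
      𝒯.arrival (fun t i => F i (x t i) - F i xs) j τ‖ ≤ Fintype.card ι * (L * U) :=
    fun τ h1 h2 => h.norm_sum_field_sub hL xs hU0 _ τ fun j hj => hU j τ hj h1 h2
  have hN := fun τ => h.norm_sum_noise hσ (𝒯.sub a) τ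
  have hnn : 0 ≤ Fintype.card ι * (L * U) := by positivity
  have hnn' : 0 ≤ √(Fintype.card ι) * σ := by positivity
  rw [𝒯.tracker_eq (g := fun t i => F i (x t i) + N t i) h.y_zero h.y_succ s a]
  by_cases ha : a = 𝒯.root
  · simp only [if_pos ha, sub_zero, ← hθ, hsplit, Finset.sum_add_distrib]
    have hC : ‖∑ j ∈ 𝒯.sub a, 𝒯.arrival (fun _ i => F i xs) j θ‖ ≤
        if θ ≤ d then ∑ j, ‖F j xs‖ else 0 := by
      rw [ha, 𝒯.sub_root]
      split_ifs with hd
      · refine norm_sum_le_of_le _ fun j _ => ?_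
        unfold ParentTree.arrival
        split_ifs <;> simp
      · rw [Finset.sum_congr rfl fun j _ => hfar j θ (by omega), h.sum_eq_zero, norm_zero]
    refine (norm_add₃_le).trans ?_
    have := hA θ le_rfl (by omega)
    have := hN θ
    linarith
  · have hd1 := 𝒯.dep_pos ha
    simp only [if_neg ha, ← hθ, hsplit]
    have hC : ‖∑ j ∈ 𝒯.sub a, (𝒯.arrival (fun _ i => F i xs) j θ
        - 𝒯.arrival (fun _ i => F i xs) j (θ - 1))‖ ≤ if θ ≤ d then ∑ j, ‖F j xs‖ else 0 := by
      split_ifs with hd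
      · refine (norm_sum_le _ _).trans ?_
        refine (Finset.sum_le_sum fun j _ => ?_).trans (Finset.sum_le_sum_of_subset_of_nonneg
          (Finset.subset_univ _) fun j _ _ => norm_nonneg (F j xs))
        unfold ParentTree.arrival
        split_ifs <;> simp
      · rw [Finset.sum_eq_zero, norm_zero]
        intro j _
        rw [hfar j θ (by omega), hfar j (θ - 1) (by omega), sub_self]
    have hrew : ∀ j, 𝒯.arrival (fun t i => F i (x t i) - F i xs) j θ + 𝒯.arrival N j θ
        + 𝒯.arrival (fun _ i => F i xs) j θ
        - (𝒯.arrival (fun t i => F i (x t i) - F i xs) j (θ - 1) + 𝒯.arrival N j (θ - 1)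
        + 𝒯.arrival (fun _ i => F i xs) j (θ - 1))
        = (𝒯.arrival (fun t i => F i (x t i) - F i xs) j θ
            - 𝒯.arrival (fun t i => F i (x t i) - F i xs) j (θ - 1))
          + (𝒯.arrival N j θ - 𝒯.arrival N j (θ - 1))
          + (𝒯.arrival (fun _ i => F i xs) j θ - 𝒯.arrival (fun _ i => F i xs) j (θ - 1)) := by
      intro j; abel
    rw [Finset.sum_congr rfl fun j _ => hrew j, Finset.sum_add_distrib, Finset.sum_add_distrib]
    refine (norm_add₃_le).trans (add_le_add (add_le_add ?_ ?_) hC)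
    · rw [Finset.sum_sub_distrib]
      refine (norm_sub_le _ _).trans ?_
      have := hA θ le_rfl (by omega)
      have := hA (θ - 1) (by omega) (by omega)
      linarith
    · rw [Finset.sum_sub_distrib]
      refine (norm_sub_le _ _).trans ?_
      have := hN θ
      have := hN (θ - 1)
      linarith

/-- The arriving noise is orthogonal to the rest of the update, so by Pythagoras it only adds its
own square. -/
lemma root_step (h : TreePushPull 𝒯 γ L μ σ d F N x y x0 xs) (t : ℕ) :
    ‖x (t + 1) 𝒯.root - xs‖ ^ 2 ≤
      ‖x t 𝒯.root - xs - γ • ∑ j, 𝒯.arrival (fun t i => F i (x t i)) j t‖ ^ 2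
        + γ ^ 2 * (Fintype.card ι * σ ^ 2) := by
  have hy : y t 𝒯.root = ∑ j, 𝒯.arrival (fun t i => F i (x t i)) j t
      + ∑ j, 𝒯.arrival N j t := by
    rw [𝒯.tracker_eq (g := fun t i => F i (x t i) + N t i) h.y_zero h.y_succ t, 𝒯.sub_root]
    simp [𝒯.dep_root, 𝒯.arrival_add, Finset.sum_add_distrib]
  have horth : inner ℝ (x t 𝒯.root - xs - γ • ∑ j, 𝒯.arrival (fun t i => F i (x t i)) j t)
      (γ • ∑ j, 𝒯.arrival N j t) = 0 := by
    rw [inner_smul_right, inner_sum, Finset.sum_eq_zero, mul_zero]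
    intro j _
    rw [real_inner_comm, inner_sub_right, h.noise_orthogonal_root, inner_smul_right, inner_sum,
      Finset.sum_eq_zero fun i _ => h.noise_orthogonal_field t j i]
    simp
  have hrew : x (t + 1) 𝒯.root - xs =
      (x t 𝒯.root - xs - γ • ∑ j, 𝒯.arrival (fun t i => F i (x t i)) j t)
        - γ • ∑ j, 𝒯.arrival N j t := by
    rw [h.x_succ, 𝒯.par_root, hy, smul_add]; abel
  rw [hrew, norm_sub_sq_real, horth, norm_smul, mul_pow, Real.norm_eq_abs, sq_abs]
  have := mul_le_mul_of_nonneg_left (h.norm_sum_noise_sq Finset.univ t) (sq_nonneg γ)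
  linarith

/-- Some messages may still be under way, so strong monotonicity of the full sum is unavailable. The
arrived fields are bounded in norm by their values at `x0` plus the drift `M`, and Young's
inequality charges a growth factor `1 + b`. -/
lemma early_step (h : TreePushPull 𝒯 γ L μ σ d F N x y x0 xs) (hL : 0 ≤ L) (hγ : 0 ≤ γ)
    {b G M : ℝ} (hb : 0 < b) (hM0 : 0 ≤ M) (hG : ∑ i, ‖F i x0‖ ≤ Fintype.card ι * (L * G)) (t : ℕ)
    (hM : ∀ j, 𝒯.dep j ≤ t → ‖x (t - 𝒯.dep j) j - x0‖ ≤ M) :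
    ‖x (t + 1) 𝒯.root - xs‖ ^ 2 ≤ (1 + b) * ‖x t 𝒯.root - xs‖ ^ 2
      + (1 + 1 / b) * (γ * Fintype.card ι * L * (G + M)) ^ 2
      + γ ^ 2 * (Fintype.card ι * σ ^ 2) := by
  refine (h.root_step t).trans (add_le_add_left ?_ _)
  refine (norm_sub_sq_le_young hb _ _).trans ?_
  have hsum : ‖∑ j, 𝒯.arrival (fun t i => F i (x t i)) j t‖
      ≤ Fintype.card ι * (L * M) + Fintype.card ι * (L * G) := by
    have hs : ∀ j, 𝒯.arrival (fun t i => F i (x t i)) j t =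
        𝒯.arrival (fun t i => F i (x t i) - F i x0) j t + 𝒯.arrival (fun _ i => F i x0) j t := by
      intro j
      rw [← 𝒯.arrival_add]; simp
    rw [Finset.sum_congr rfl fun j _ => hs j, Finset.sum_add_distrib]
    refine (norm_add_le _ _).trans (add_le_add (h.norm_sum_field_sub hL x0 hM0 _ t hM) ?_)
    refine (norm_sum_le_of_le _ fun j _ => ?_).trans hG
    unfold ParentTree.arrival
    split_ifs <;> simp
  have hn : ‖γ • ∑ j, 𝒯.arrival (fun t i => F i (x t i)) j t‖
      ≤ γ * Fintype.card ι * L * (G + M) := by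
    rw [norm_smul, Real.norm_of_nonneg hγ]
    refine (mul_le_mul_of_nonneg_left hsum hγ).trans (le_of_eq (by ring))
  gcongr

/-- Once `d ≤ t` every node has arrived, and the sum is the full field at the root's iterate plus a
staleness error. The former contracts by strong monotonicity; Young's inequality splits off the
latter. -/
lemma late_step (h : TreePushPull 𝒯 γ L μ σ d F N x y x0 xs) (hL : 0 ≤ L) (hγ : 0 ≤ γ)
    {b E : ℝ} (hb : 0 < b) (hE0 : 0 ≤ E) {t : ℕ} (ht : d ≤ t)
    (hE : ∀ j, ‖x (t - 𝒯.dep j) j - x t 𝒯.root‖ ≤ E) :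
    ‖x (t + 1) 𝒯.root - xs‖ ^ 2 ≤
      (1 + b) * ((1 - 2 * (γ * Fintype.card ι * μ) + (γ * Fintype.card ι * L) ^ 2)
        * ‖x t 𝒯.root - xs‖ ^ 2)
      + (1 + 1 / b) * (γ * Fintype.card ι * L * E) ^ 2
      + γ ^ 2 * (Fintype.card ι * σ ^ 2) := by
  refine (h.root_step t).trans (add_le_add_left ?_ _)
  set w := x t 𝒯.root with hw
  set A := ∑ j, 𝒯.arrival (fun t i => F i (x t i) - F i w) j t with hA
  have hsum : ∑ j, 𝒯.arrival (fun t i => F i (x t i)) j t = ∑ j, F j w + A := by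
    rw [hA, ← Finset.sum_add_distrib]
    refine Finset.sum_congr rfl fun j _ => ?_
    unfold ParentTree.arrival
    rw [if_pos ((h.dep_le j).trans ht), if_pos ((h.dep_le j).trans ht)]
    beta_reduce; abel
  have hAn : ‖γ • A‖ ≤ γ * Fintype.card ι * L * E := by
    rw [norm_smul, Real.norm_of_nonneg hγ]
    refine (mul_le_mul_of_nonneg_left
      (h.norm_sum_field_sub hL w hE0 Finset.univ t fun j _ => hE j) hγ).trans
      (le_of_eq (by ring))
  have hFn : ‖∑ j, F j w‖ ≤ Fintype.card ι * (L * ‖w - xs‖) := by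
    have : ∑ j, F j w = ∑ j, (F j w - F j xs) := by
      rw [Finset.sum_sub_distrib, h.sum_eq_zero, sub_zero]
    rw [this]
    refine (norm_sum_le_of_le _ fun j _ => h.lipschitz j w xs).trans (le_of_eq ?_)
    rw [Finset.sum_const, nsmul_eq_mul, Finset.card_univ]
  have hmain : ‖w - xs - γ • ∑ j, F j w‖ ^ 2 ≤
      (1 - 2 * (γ * Fintype.card ι * μ) + (γ * Fintype.card ι * L) ^ 2) * ‖w - xs‖ ^ 2 := by
    rw [norm_sub_sq_real, inner_smul_right, real_inner_comm, norm_smul, mul_pow,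
      Real.norm_eq_abs, sq_abs]
    have h1 := mul_le_mul_of_nonneg_left (h.strongly_monotone w) hγ
    have h2 : ‖∑ j, F j w‖ ^ 2 ≤ (Fintype.card ι * (L * ‖w - xs‖)) ^ 2 := by gcongr
    have h3 := mul_le_mul_of_nonneg_left h2 (sq_nonneg γ)
    nlinarith
  rw [hsum, smul_add, ← sub_sub]
  refine (norm_sub_sq_le_young hb _ _).trans ?_
  gcongr

end TreePushPull

/-! ### Decay profile and scalar inequalities -/

/-- The decay profile of the mean squared error: slow growth during the `d` steps in which the
first messages travel to the root, geometric decay afterwards. -/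
def decayProfile (q : ℝ) (d t : ℕ) : ℝ := (1 + 3 / 4 * q) ^ min t d * (1 - q) ^ (t - d)

section Scalars

variable {q a ν : ℝ} {d : ℕ}

lemma decayProfile_succ_of_lt {t : ℕ} (h : t < d) :
    decayProfile q d (t + 1) = (1 + 3 / 4 * q) * decayProfile q d t := by
  unfold decayProfile
  rw [min_eq_left h, min_eq_left h.le, show t + 1 - d = 0 by omega, show t - d = 0 by omega,
    pow_succ]
  ring

lemma decayProfile_succ_of_le {t : ℕ} (h : d ≤ t) :
    decayProfile q d (t + 1) = (1 - q) * decayProfile q d t := by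
  unfold decayProfile
  rw [min_eq_right h, min_eq_right (by omega), show t + 1 - d = t - d + 1 by omega, pow_succ]
  ring

lemma decayProfile_pos (hq : 0 < q) (hq1 : q < 1) (t : ℕ) : 0 < decayProfile q d t := by
  unfold decayProfile
  have : 0 < 1 - q := by linarith
  positivity

lemma one_le_decayProfile (hq : 0 < q) {t : ℕ} (h : t ≤ d) : 1 ≤ decayProfile q d t := by
  unfold decayProfile
  rw [show t - d = 0 by omega, pow_zero, mul_one]
  exact one_le_pow₀ (by linarith)

lemma decayProfile_le (hq : 0 < q) (hdq : d * q ≤ 1 / 100) {t : ℕ} (h : t ≤ d) :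
    decayProfile q d t ≤ 11 / 10 := by
  unfold decayProfile
  rw [show t - d = 0 by omega, pow_zero, mul_one, min_eq_left h]
  calc (1 + 3 / 4 * q) ^ t ≤ (1 + 3 / 4 * q) ^ d := pow_le_pow_right₀ (by linarith) h
    _ ≤ Real.exp (3 / 4 * q) ^ d := by
        gcongr
        linarith [Real.add_one_le_exp (3 / 4 * q)]
    _ = Real.exp (d * (3 / 4 * q)) := (Real.exp_nat_mul _ _).symm
    _ ≤ Real.exp (1 / 50) := Real.exp_le_exp.2 (by linarith)
    _ ≤ 1 / (1 - 1 / 50) := Real.exp_bound_div_one_sub_of_interval (by norm_num) (by norm_num)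
    _ ≤ 11 / 10 := by norm_num

/-- One step loses at most a factor `1 - q`; over `3 * d` steps Bernoulli leaves at least 1 - 3dq ≥
97/100, and 100/97 ≤ 26/25. -/
lemma decayProfile_window (hq : 0 < q) (hq1 : q < 1) (hdq : d * q ≤ 1 / 100) {τ t : ℕ}
    (h : τ ≤ t) (h' : t ≤ τ + 3 * d) :
    decayProfile q d τ ≤ 26 / 25 * decayProfile q d t := by
  have hstep : ∀ k, (1 - q) ^ k * decayProfile q d τ ≤ decayProfile q d (τ + k) := by
    intro k
    induction k with
    | zero => simp
    | succ k ih =>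
      have h1 : (1 - q) * decayProfile q d (τ + k) ≤ decayProfile q d (τ + k + 1) := by
        rcases lt_or_ge (τ + k) d with hlt | hge
        · rw [decayProfile_succ_of_lt hlt]
          have := decayProfile_pos (d := d) hq hq1 (τ + k)
          gcongr
          linarith
        · rw [decayProfile_succ_of_le hge]
      rw [← add_assoc]
      refine le_trans ?_ h1
      rw [pow_succ', mul_assoc]
      have : 0 ≤ 1 - q := by linarith
      gcongr
  obtain ⟨k, rfl⟩ := Nat.exists_eq_add_of_le h
  have hk : (k : ℝ) ≤ 3 * d := by exact_mod_cast (by omega : k ≤ 3 * d)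
  have hb := one_add_mul_le_pow (show (-2 : ℝ) ≤ -q by linarith) k
  have hkq : (k : ℝ) * q ≤ 3 / 100 := by nlinarith
  have hp := decayProfile_pos (d := d) hq hq1 τ
  have h97 : (97 / 100 : ℝ) ≤ (1 - q) ^ k := by
    rw [← sub_eq_add_neg] at hb
    linarith
  have := mul_le_mul_of_nonneg_right h97 hp.le
  have := hstep k
  linarith

/-- The exponent is q(7d/4 - t), and d ≤ t/2 makes it at most -qt/8. -/
lemma decayProfile_le_exp (hq : 0 < q) (hq1 : q < 1) {t : ℕ} (h : 2 * d ≤ t) :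
    decayProfile q d t ≤ Real.exp (-(q * t / 8)) := by
  unfold decayProfile
  rw [min_eq_right (by omega)]
  calc (1 + 3 / 4 * q) ^ d * (1 - q) ^ (t - d)
      ≤ Real.exp (3 / 4 * q) ^ d * Real.exp (-q) ^ (t - d) := by
        have h0 : 0 ≤ 1 - q := by linarith
        gcongr
        · linarith [Real.add_one_le_exp (3 / 4 * q)]
        · linarith [Real.add_one_le_exp (-q)]
    _ = Real.exp (d * (3 / 4 * q) + (t - d : ℕ) * (-q)) := by
        rw [← Real.exp_nat_mul, ← Real.exp_nat_mul, ← Real.exp_add]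
    _ ≤ _ := by
        rw [Real.exp_le_exp, Nat.cast_sub (by omega)]
        have h2 : (2 : ℝ) * d ≤ t := by exact_mod_cast h
        nlinarith

/-- Each early step may spend `G ^ 2 / D` and `17 * ν ^ 2`, so that `d` steps spend `G ^ 2` once.
The growth 3q/4 covers Young's q/4 and the share 0.414 q of the source; the noise totals 14.1 + 3 ·
0.414 + 1 ≤ 17. -/
lemma early_scalar {p V G r s t D : ℝ} (hq : 0 < q) (hD : 1 ≤ D)
    (hDq : D * q ≤ 1 / 100) (haq : 100 * (D * a) ^ 2 ≤ q) (hp : 1 ≤ p) (ht : 0 ≤ t)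
    (hs : s ^ 2 = p * (r ^ 2 + G ^ 2) + 3 * ν ^ 2 / q)
    (hV : V ≤ p * (r ^ 2 + t / D * G ^ 2 + 17 * t * ν ^ 2)) :
    (1 + q / 4) * V + (1 + 1 / (q / 4)) *
        (a * (G + 4 / 3 * (12 * (D * a) * s + 7 * D * ν))) ^ 2 + ν ^ 2
      ≤ (1 + 3 / 4 * q) * p * (r ^ 2 + (t + 1) / D * G ^ 2 + 17 * (t + 1) * ν ^ 2) := by
  have hD0 : 0 < D := by linarith
  have hq1 : q ≤ 1 / 100 := by nlinarith
  -- Young's factor 4/q meets `a ^ 2`; the quotient `k` stays small since `k * D ^ 2 ≤ 1 / 100`.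
  obtain ⟨k, hk⟩ : ∃ k, k = a ^ 2 / q := ⟨_, rfl⟩
  have hk0 : 0 ≤ k := by rw [hk]; positivity
  have hak : a ^ 2 = k * q := by rw [hk]; field_simp
  have hkD2 : k * D ^ 2 ≤ 1 / 100 := by
    rw [mul_pow, hak] at haq
    have : (100 * (k * D ^ 2)) * q ≤ 1 * q := by linarith
    have := le_of_mul_le_mul_right this hq
    linarith
  have hkD : k * D ≤ 1 / 100 := le_trans (by nlinarith [mul_nonneg hk0 hD0.le]) hkD2
  have hk1 : k ≤ 1 / 100 := le_trans (by nlinarith) hkD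
  have hqs : q * s ^ 2 = q * p * (r ^ 2 + G ^ 2) + 3 * ν ^ 2 := by rw [hs]; field_simp
  have hkl : k * (D * a) ^ 2 ≤ q / 10000 := by
    have := mul_le_mul hk1 haq (by positivity) (by norm_num)
    linarith
  have hkG : k * G ^ 2 ≤ 1 / 100 * (G ^ 2 / D) := by
    have : k ≤ 1 / 100 / D := by rw [le_div_iff₀ hD0]; exact hkD
    calc k * G ^ 2 ≤ 1 / 100 / D * G ^ 2 := by gcongr
      _ = _ := by ring
  have hqG : q * G ^ 2 ≤ 1 / 100 * (G ^ 2 / D) := by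
    have : q ≤ 1 / 100 / D := by rw [le_div_iff₀ hD0]; linarith
    calc q * G ^ 2 ≤ 1 / 100 / D * G ^ 2 := by gcongr
      _ = _ := by ring
  have hE : (12 * (D * a) * s + 7 * D * ν) ^ 2 ≤ 288 * ((D * a) ^ 2 * s ^ 2) + 98 * (D ^ 2 * ν ^ 2) := by
    nlinarith [sq_nonneg (12 * (D * a) * s - 7 * D * ν)]
  set E := 12 * (D * a) * s + 7 * D * ν with hEdef
  have hGM : (G + 4 / 3 * E) ^ 2 ≤ 2 * G ^ 2 + 32 / 9 * E ^ 2 := by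
    nlinarith [sq_nonneg (G - 4 / 3 * E)]
  have hcoef : (1 + 1 / (q / 4)) * (a * (G + 4 / 3 * E)) ^ 2
      ≤ 404 / 100 * (k * (G + 4 / 3 * E) ^ 2) := by
    rw [mul_pow, hak]
    have : (1 + 1 / (q / 4)) * (k * q * (G + 4 / 3 * E) ^ 2) =
        (q + 4) * (k * (G + 4 / 3 * E) ^ 2) := by field_simp
    rw [this]
    gcongr
    linarith
  have h1 := mul_le_mul_of_nonneg_left hGM hk0
  have h2 := mul_le_mul_of_nonneg_left hE hk0
  have h3 := mul_le_mul_of_nonneg_right hkl (sq_nonneg s)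
  have h4 := mul_le_mul_of_nonneg_right hkD2 (sq_nonneg ν)
  have hsrc : (1 + 1 / (q / 4)) * (a * (G + 4 / 3 * E)) ^ 2 ≤
      9 / 100 * (G ^ 2 / D) + 414 / 1000 * (q * s ^ 2) + 141 / 10 * ν ^ 2 := by
    have e0 : 0 ≤ q * s ^ 2 := by positivity
    have e1 : 0 ≤ G ^ 2 / D := by positivity
    have e2 := sq_nonneg ν
    linarith only [hcoef, h1, hkG, e1, h2, h3, h4, e0, e2]
  rw [hqs] at hsrc
  have hV' := mul_le_mul_of_nonneg_left hV (show 0 ≤ 1 + q / 4 by linarith)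
  have eG : (t + 1) / D * G ^ 2 = t / D * G ^ 2 + G ^ 2 / D := by ring
  rw [eG]
  have g1 : 0 ≤ G ^ 2 / D := by positivity
  have g2 : 0 ≤ t / D * G ^ 2 := by positivity
  have m1 : 0 ≤ q * p * (t / D * G ^ 2) := by positivity
  have m2 : 0 ≤ q * p * (t * ν ^ 2) := by positivity
  have m3 : 0 ≤ q * p * r ^ 2 := by positivity
  have m4 : G ^ 2 / D ≤ p * (G ^ 2 / D) := le_mul_of_one_le_left g1 hp
  have m5 : ν ^ 2 ≤ p * ν ^ 2 := le_mul_of_one_le_left (sq_nonneg ν) hp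
  have m6 : p * (q * G ^ 2) ≤ p * (1 / 100 * (G ^ 2 / D)) := by gcongr
  have m7 : 0 ≤ q * p * (G ^ 2 / D) := by positivity
  have m8 : 0 ≤ q * p * ν ^ 2 := by positivity
  have m0 := sq_nonneg ν
  generalize (1 + 1 / (q / 4)) * (a * (G + 4 / 3 * E)) ^ 2 = S at hsrc ⊢
  linarith only [hsrc, hV', g1, m0, m1, m2, m3, m4, m5, m6, m7, m8]

/-- The damping 1.49 q outweighs the source 0.06 q s² + 2ν², leaving 1.43 q s². The part 3ν²/q of s²
then loses 4.29 ν² and regains at most 3ν², so that level persists. -/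
lemma late_scalar {p V R s D : ℝ} (hq : 0 < q) (hD : 1 ≤ D)
    (hDq : D * q ≤ 1 / 100) (haq : 100 * (D * a) ^ 2 ≤ q) (hp : 0 < p) (hR : 0 ≤ R)
    (hs : s ^ 2 = p * R + 3 * ν ^ 2 / q) (hV0 : 0 ≤ V) (hV : V ≤ s ^ 2) :
    (1 + q / 2) * ((1 - 2 * q + a ^ 2) * V) + (1 + 1 / (q / 2)) *
        (a * (12 * (D * a) * s + 7 * D * ν)) ^ 2 + ν ^ 2
      ≤ (1 - q) * p * R + 3 * ν ^ 2 / q := by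
  have hD0 : 0 < D := by linarith
  have hq1 : q ≤ 1 / 100 := by nlinarith
  obtain ⟨k, hk⟩ : ∃ k, k = a ^ 2 / q := ⟨_, rfl⟩
  have hk0 : 0 ≤ k := by rw [hk]; positivity
  have hak : a ^ 2 = k * q := by rw [hk]; field_simp
  have hkD2 : k * D ^ 2 ≤ 1 / 100 := by
    rw [mul_pow, hak] at haq
    have : (100 * (k * D ^ 2)) * q ≤ 1 * q := by linarith
    have := le_of_mul_le_mul_right this hq
    linarith
  have hk1 : k ≤ 1 / 100 := le_trans (by nlinarith [one_le_pow₀ hD (n := 2)]) hkD2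
  have hqs : q * s ^ 2 = q * p * R + 3 * ν ^ 2 := by rw [hs]; field_simp
  have hkl : k * (D * a) ^ 2 ≤ q / 10000 := by
    have := mul_le_mul hk1 haq (by positivity) (by norm_num)
    linarith
  have hE : (12 * (D * a) * s + 7 * D * ν) ^ 2 ≤ 288 * ((D * a) ^ 2 * s ^ 2) + 98 * (D ^ 2 * ν ^ 2) := by
    nlinarith [sq_nonneg (12 * (D * a) * s - 7 * D * ν)]
  set E := 12 * (D * a) * s + 7 * D * ν with hEdef
  have hcoef : (1 + 1 / (q / 2)) * (a * E) ^ 2 ≤ 201 / 100 * (k * E ^ 2) := by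
    rw [mul_pow, hak]
    have : (1 + 1 / (q / 2)) * (k * q * E ^ 2) = (q + 2) * (k * E ^ 2) := by field_simp
    rw [this]
    gcongr
    linarith
  have h2 := mul_le_mul_of_nonneg_left hE hk0
  have h3 := mul_le_mul_of_nonneg_right hkl (sq_nonneg s)
  have h4 := mul_le_mul_of_nonneg_right hkD2 (sq_nonneg ν)
  have hsrc : (1 + 1 / (q / 2)) * (a * E) ^ 2 ≤ 6 / 100 * (q * s ^ 2) + 2 * ν ^ 2 := by
    have e0 : 0 ≤ q * s ^ 2 := by positivity
    have e2 := sq_nonneg ν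
    linarith only [hcoef, h2, h3, h4, e0, e2]
  have hmain : (1 + q / 2) * ((1 - 2 * q + a ^ 2) * V) ≤ (1 - 149 / 100 * q) * s ^ 2 := by
    have hc : (1 + q / 2) * (1 - 2 * q + a ^ 2) ≤ 1 - 149 / 100 * q := by
      rw [hak]; nlinarith [mul_le_mul_of_nonneg_right hk1 hq.le]
    rw [← mul_assoc]
    exact mul_le_mul hc hV hV0 (by linarith)
  have hR' : 0 ≤ q * p * R := by positivity
  have hs2 : (1 - 149 / 100 * q) * s ^ 2 = s ^ 2 - 149 / 100 * (q * s ^ 2) := by ring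
  rw [hs2] at hmain
  nlinarith [sq_nonneg ν]

/-- This closes the loop: the constants 12 and 7 also enter through `U`, but multiplied by the small
`D * a`. The totals are about 11.3 and 6.5. -/
lemma consensus_scalar {D s Z U : ℝ} (hD : 1 ≤ D) (ha : 0 ≤ a) (hDa : D * a ≤ 1 / 100)
    (hs : 0 ≤ s) (hν : 0 ≤ ν) (hZ : Z ≤ 145 / 100 * s)
    (hU : U = 102 / 100 * s * (1 + 12 * (D * a)) + 7 * D * ν) :
    3 * D * (2 * (a * U) + 2 * ν + a * Z) ≤ 12 * (D * a) * s + 7 * D * ν := by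
  have h1 : D * a * Z ≤ D * a * (145 / 100 * s) := by gcongr
  have h2 : D * a * (D * a * s) ≤ 1 / 100 * (D * a * s) := by gcongr
  have h3 : D * a * (D * ν) ≤ 1 / 100 * (D * ν) := by gcongr
  have h4 : 0 ≤ D * a * s := by positivity
  have h5 : 0 ≤ D * ν := by positivity
  rw [hU]
  nlinarith

end Scalars

/-! ### The induction for the root error -/

namespace TreePushPull

variable {ι : Type*} [Fintype ι] [DecidableEq ι] {𝒯 : ParentTree ι}
  {H : Type*} [NormedAddCommGroup H] [InnerProductSpace ℝ H]
  {γ L μ σ : ℝ} {d : ℕ} {F : ι → H → H} {N x y : ℕ → ι → H} {x0 xs : H}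

lemma sum_norm_field_le (h : TreePushPull 𝒯 γ L μ σ d F N x y x0 xs) {G : ℝ}
    (hG : ∑ i, ‖F i x0‖ ≤ Fintype.card ι * (L * G)) :
    ∑ i, ‖F i xs‖ ≤ Fintype.card ι * (L * (‖x0 - xs‖ + G)) := by
  calc ∑ i, ‖F i xs‖ ≤ ∑ i, (‖F i x0‖ + L * ‖x0 - xs‖) := Finset.sum_le_sum fun i _ => by
        have h1 := h.lipschitz i x0 xs
        have h2 := norm_sub_norm_le (F i xs) (F i x0)
        rw [norm_sub_rev] at h2
        linarith
    _ = ∑ i, ‖F i x0‖ + Fintype.card ι * (L * ‖x0 - xs‖) := by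
        rw [Finset.sum_add_distrib, Finset.sum_const, nsmul_eq_mul, Finset.card_univ]
    _ ≤ _ := by linarith

set_option maxHeartbeats 1000000 in
/-- Mean squared error of the root under B-ary Tree Push-Pull. -/
theorem root_error (h : TreePushPull 𝒯 γ L μ σ d F N x y x0 xs) (hd : 1 ≤ d) (hγ : 0 < γ)
    (hμ : 0 < μ) (hμL : μ ≤ L) (hσ : 0 ≤ σ) {G : ℝ} (hG0 : 0 ≤ G)
    (hG : ∑ i, ‖F i x0‖ ≤ Fintype.card ι * (L * G))
    (hstep : 100 * Fintype.card ι * d ^ 2 * L ^ 2 * γ ≤ μ) {T : ℕ} (hT : 2 * d ≤ T) :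
    ‖x T 𝒯.root - xs‖ ^ 2 ≤
      Real.exp (-(γ * Fintype.card ι * μ * T / 8)) * (‖x0 - xs‖ ^ 2 + G ^ 2)
        + 3 * γ * σ ^ 2 / μ := by
  have hn : 0 < (Fintype.card ι : ℝ) := by
    exact_mod_cast Fintype.card_pos_iff.2 ⟨𝒯.root⟩
  set n : ℝ := (Fintype.card ι : ℝ) with hn_def
  have hL : 0 < L := hμ.trans_le hμL
  set q := γ * n * μ with hq_def
  set a := γ * n * L with ha_def
  set ν := γ * (√n * σ) with hν_def
  set r := ‖x0 - xs‖ with hr_def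
  have hD : (1 : ℝ) ≤ d := by exact_mod_cast hd
  have hq : 0 < q := by positivity
  have ha : 0 < a := by positivity
  have hν : 0 ≤ ν := by positivity
  have hν2 : γ ^ 2 * (n * σ ^ 2) = ν ^ 2 := by
    rw [hν_def, mul_pow, mul_pow, Real.sq_sqrt hn.le]
  have hqa : q ≤ a := by rw [hq_def, ha_def]; gcongr
  have haq : 100 * (d * a) ^ 2 ≤ q := by
    have := mul_le_mul_of_nonneg_left hstep (by positivity : 0 ≤ γ * n)
    rw [hq_def, ha_def]
    linarith
  have hda : d * a ≤ 1 / 100 := by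
    have h1 : a ≤ d * a := by nlinarith
    have h2 : 0 < d * a := by positivity
    nlinarith
  have hdq : d * q ≤ 1 / 100 := le_trans (by gcongr) hda
  have hq1 : q < 1 := by nlinarith
  set R := r ^ 2 + G ^ 2 with hR_def
  have hR : 0 ≤ R := by positivity
  obtain ⟨s, hs⟩ : ∃ s : ℕ → ℝ, ∀ t, s t = √(decayProfile q d t * R + 3 * ν ^ 2 / q) :=
    ⟨_, fun _ => rfl⟩
  have hp := fun t => decayProfile_pos (d := d) hq hq1 t
  have hs2 : ∀ t, s t ^ 2 = decayProfile q d t * R + 3 * ν ^ 2 / q := fun t => by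
    rw [hs, Real.sq_sqrt]
    have := (hp t).le
    positivity
  have hs0 : ∀ t, 0 ≤ s t := fun t => by rw [hs]; positivity
  have hwin : ∀ τ t, τ ≤ t → t ≤ τ + 3 * d → s τ ≤ 102 / 100 * s t := by
    intro τ t h1 h2
    refine abs_le_of_sq_le_sq' ?_ (mul_nonneg (by norm_num) (hs0 t)) |>.2
    rw [mul_pow, hs2, hs2]
    have h3 := mul_le_mul_of_nonneg_right (decayProfile_window hq hq1 hdq h1 h2) hR
    have h4 : 0 ≤ 3 * ν ^ 2 / q := by positivity
    have h5 := mul_nonneg (hp t).le hR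
    nlinarith
  -- Here (r + G)² ≤ 2R and 2 · 26/25 ≤ 1.45².
  have hinit : ∀ t, t ≤ 3 * d → r + G ≤ 145 / 100 * s t := by
    intro t ht
    refine abs_le_of_sq_le_sq' ?_ (mul_nonneg (by norm_num) (hs0 t)) |>.2
    rw [mul_pow, hs2]
    have h3 := mul_le_mul_of_nonneg_right
      (decayProfile_window (τ := 0) hq hq1 hdq (Nat.zero_le t) (by omega)) hR
    have h0 : 1 ≤ decayProfile q d 0 := one_le_decayProfile hq (Nat.zero_le d)
    have h4 : 0 ≤ 3 * ν ^ 2 / q := by positivity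
    have h5 := mul_nonneg (hp t).le hR
    have h6 := mul_le_mul_of_nonneg_right h0 hR
    have h7 : (r + G) ^ 2 ≤ 2 * R := by rw [hR_def]; nlinarith [sq_nonneg (r - G)]
    nlinarith
  obtain ⟨E, hE⟩ : ∃ E : ℕ → ℝ, ∀ t, E t = 12 * (d * a) * s t + 7 * d * ν := ⟨_, fun _ => rfl⟩
  have hE0 : ∀ t, 0 ≤ E t := fun t => by
    rw [hE]
    have := hs0 t
    positivity
  -- Trackers with clock in [t - 2d, t) involve arrivals at times down to t - 2d - 1 ≥ t - 3d, hence
  -- the window of `3 * d`. The constants `F j xs` occur only for clock at most `d`, that is for t ≤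
  -- 3d, where `hinit` absorbs them.
  have hcons : ∀ t, (∀ τ < t, ‖x τ 𝒯.root - xs‖ ≤ s τ ∧
      ∀ i, 𝒯.dep i ≤ τ → ‖x (τ - 𝒯.dep i) i - x τ 𝒯.root‖ ≤ E τ) →
      ∃ Y, 0 ≤ Y ∧ 3 * d * (γ * Y) ≤ E t ∧
        ∀ u b, t ≤ u + 𝒯.dep b + 2 * d → u + 𝒯.dep b < t → ‖y u b‖ ≤ Y := by
    intro t ih
    obtain ⟨U, hU⟩ : ∃ U, U = 102 / 100 * s t * (1 + 12 * (d * a)) + 7 * d * ν := ⟨_, rfl⟩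
    have hst := hs0 t
    have hU0 : 0 ≤ U := by rw [hU]; positivity
    obtain ⟨Z, hZ⟩ : ∃ Z : ℝ, Z = if t ≤ 3 * d then r + G else 0 := ⟨_, rfl⟩
    have hZ0 : 0 ≤ Z := by rw [hZ]; split_ifs <;> positivity
    have hZs : Z ≤ 145 / 100 * s t := by
      rw [hZ]
      split_ifs with ht
      · exact hinit t ht
      · positivity
    refine ⟨2 * (n * (L * U)) + 2 * (√n * σ) + n * (L * Z), by positivity, ?_, ?_⟩
    · rw [hE]
      refine le_trans (le_of_eq ?_)
        (consensus_scalar hD ha.le hda hst hν hZs hU)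
      rw [ha_def, hν_def]
      ring
    · intro u b hub hub'
      refine (h.tracker_bound hL.le hσ hU0 u b ?_).trans ?_
      · intro j τ hj h1 h2
        obtain ⟨i1, i2⟩ := ih τ (by omega)
        have i3 := i2 j hj
        have hw := hwin τ t (by omega) (by omega)
        have hEt : E τ ≤ 12 * (d * a) * (102 / 100 * s t) + 7 * d * ν := by
          rw [hE]; gcongr
        calc ‖x (τ - 𝒯.dep j) j - xs‖
            = ‖(x (τ - 𝒯.dep j) j - x τ 𝒯.root) + (x τ 𝒯.root - xs)‖ := by congr 1; abel
          _ ≤ E τ + s τ := (norm_add_le _ _).trans (add_le_add i3 i1)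
          _ ≤ U := by rw [hU]; linarith only [hEt, hw]
      · refine add_le_add le_rfl ?_
        rw [hZ]
        by_cases hub2 : u + 𝒯.dep b ≤ d
        · rw [if_pos hub2, if_pos (by omega)]
          exact h.sum_norm_field_le hG
        · rw [if_neg hub2]
          split_ifs <;> positivity
  -- Before time `d` a finer budget than `s t ^ 2` is carried, growing linearly with the number of
  -- steps; by `hearly` it fits below `s t ^ 2`.
  obtain ⟨Φ, hΦ⟩ : ∃ Φ : ℕ → ℝ, ∀ t, Φ t = if t < d then
      decayProfile q d t * (r ^ 2 + t / d * G ^ 2 + 17 * t * ν ^ 2) else s t ^ 2 :=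
    ⟨_, fun _ => rfl⟩
  have hearly : ∀ t, t ≤ d →
      decayProfile q d t * (r ^ 2 + t / d * G ^ 2 + 17 * t * ν ^ 2) ≤ s t ^ 2 := by
    intro t ht
    have htd : (t : ℝ) ≤ d := by exact_mod_cast ht
    have h1 : (t : ℝ) / d ≤ 1 := by rw [div_le_one (by linarith)]; exact htd
    rw [hs2, mul_add]
    have h2 : r ^ 2 + t / d * G ^ 2 ≤ R := by
      rw [hR_def]; nlinarith [sq_nonneg G]
    refine add_le_add (mul_le_mul_of_nonneg_left h2 (hp t).le) ?_
    rw [le_div_iff₀ hq]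
    have h3 := decayProfile_le hq hdq ht
    have h4 : t * q ≤ 1 / 100 := le_trans (by gcongr) hdq
    have h5 : decayProfile q d t * (t * q) ≤ 11 / 10 * (1 / 100) :=
      mul_le_mul h3 h4 (by positivity) (by norm_num)
    nlinarith [mul_le_mul_of_nonneg_right h5 (sq_nonneg ν), sq_nonneg ν]
  have hΦs : ∀ t, Φ t ≤ s t ^ 2 := by
    intro t
    rw [hΦ]
    split_ifs with ht
    · exact hearly t ht.le
    · exact le_rfl
  -- The staleness bound at `t` needs only times before `t`; the root bound at `t + 1` needs both
  -- bounds at `t`.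
  have main : ∀ t, ‖x t 𝒯.root - xs‖ ^ 2 ≤ Φ t ∧
      ∀ i, 𝒯.dep i ≤ t → ‖x (t - 𝒯.dep i) i - x t 𝒯.root‖ ≤ E t := by
    intro t
    induction t using Nat.strong_induction_on with
    | _ t ih =>
    have ih' : ∀ τ < t, ‖x τ 𝒯.root - xs‖ ≤ s τ ∧
        ∀ i, 𝒯.dep i ≤ τ → ‖x (τ - 𝒯.dep i) i - x τ 𝒯.root‖ ≤ E τ := fun τ hτ =>
      ⟨(abs_le_of_sq_le_sq' ((ih τ hτ).1.trans (hΦs τ)) (hs0 τ)).2, (ih τ hτ).2⟩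
    refine ⟨?_, ?_⟩
    · rcases t with _ | t
      · rw [hΦ, if_pos (by omega), h.x_zero]
        simp [decayProfile, ← hr_def]
      · obtain ⟨i1, i2⟩ := ih t (by omega)
        rcases lt_or_ge t d with htd | htd
        -- Staleness costs `E t`; the root's drift from `x0` in fewer than `d` steps costs a third
        -- of `E t`.
        · have hM : ∀ j, 𝒯.dep j ≤ t → ‖x (t - 𝒯.dep j) j - x0‖ ≤ 4 / 3 * E t := by
            intro j hj
            obtain ⟨Y, hY0, hY1, hY2⟩ := hcons t fun τ hτ => ih' τ (by omega)
            have hdr := 𝒯.root_drift hγ.le h.x_succ (Y := Y) 0 t fun u _ hu =>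
              hY2 u 𝒯.root (by omega) (by rw [𝒯.dep_root]; omega)
            rw [zero_add, h.x_zero] at hdr
            have htd' : (t : ℝ) ≤ d := by exact_mod_cast htd.le
            have h1 : t * (γ * Y) ≤ d * (γ * Y) := by gcongr
            have := i2 j hj
            calc ‖x (t - 𝒯.dep j) j - x0‖
                = ‖(x (t - 𝒯.dep j) j - x t 𝒯.root) + (x t 𝒯.root - x0)‖ := by congr 1; abel
              _ ≤ ‖x (t - 𝒯.dep j) j - x t 𝒯.root‖ + ‖x t 𝒯.root - x0‖ := norm_add_le _ _
              _ ≤ _ := by linarith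
          have hst := h.early_step hL.le hγ.le (b := q / 4) (by positivity)
            (mul_nonneg (by norm_num) (hE0 t)) hG t hM
          rw [hν2, hE] at hst
          rw [hΦ, if_pos htd] at i1
          have hsc := early_scalar hq hD hdq haq (one_le_decayProfile hq htd.le)
            (Nat.cast_nonneg t) (hs2 t) i1
          have hfin := hst.trans hsc
          rw [← decayProfile_succ_of_lt htd] at hfin
          rw [hΦ]
          split_ifs with h2
          · push_cast
            exact hfin
          · refine hfin.trans ?_
            have := hearly (t + 1) (by omega)
            push_cast at this
            exact this
        · have hst := h.late_step hL.le hγ.le (b := q / 2) (by positivity) (hE0 t) htd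
            fun j => i2 j ((h.dep_le j).trans htd)
          rw [hν2, hE] at hst
          rw [hΦ, if_neg (by omega), hs2, decayProfile_succ_of_le htd]
          exact hst.trans (late_scalar hq hD hdq haq (hp t) hR (hs2 t) (sq_nonneg _)
            (i1.trans (hΦs t)))
    · intro i hi
      obtain ⟨Y, hY0, hY1, hY2⟩ := hcons t ih'
      have hdi := h.dep_le i
      have hdi' : (𝒯.dep i : ℝ) ≤ d := by exact_mod_cast hdi
      have hce := 𝒯.consensus_error hγ.le h.x_zero h.x_succ hY0 (t - 𝒯.dep i) i fun u b hu hu' =>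
        hY2 u b (by omega) (by omega)
      rw [Nat.sub_add_cancel hi] at hce
      refine hce.trans (le_trans ?_ hY1)
      gcongr
  have hfin := (main T).1
  rw [hΦ, if_neg (by omega), hs2] at hfin
  refine hfin.trans (add_le_add ?_ (le_of_eq ?_))
  · exact mul_le_mul_of_nonneg_right (decayProfile_le_exp hq hq1 hT) hR
  · rw [← hν2, hq_def]
    field_simp

end TreePushPull

/-! ### Noise evaluated at an independent random point -/

section FreshNoise

lemma integrable_inner_of_memLp_two {Ω E : Type*} [MeasurableSpace Ω] [NormedAddCommGroup E]
    [InnerProductSpace ℝ E] {P : Measure Ω} {X Z : Ω → E} (hX : MemLp X 2 P) (hZ : MemLp Z 2 P) :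
    Integrable (fun ω => (inner ℝ (X ω) (Z ω) : ℝ)) P := by
  refine (L2.integrable_inner (𝕜 := ℝ) (hX.toLp X) (hZ.toLp Z)).congr ?_
  filter_upwards [hX.coeFn_toLp, hZ.coeFn_toLp] with ω h1 h2
  rw [h1, h2]

variable {Ω S E : Type*} [MeasurableSpace Ω] [MeasurableSpace S] [NormedAddCommGroup E]
  [MeasurableSpace E] [BorelSpace E] [SecondCountableTopology E]

/-- A random field with second moment at most `σ²`, evaluated at an independent random
point, is square integrable with second moment at most `σ²`. -/
lemma memLp_fresh_noise {P : Measure Ω} [IsProbabilityMeasure P] {D : Measure S}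
    [IsProbabilityMeasure D] {X : Ω → E} {ζ : Ω → S} (hX : Measurable X) (hζ : Measurable ζ)
    (hlaw : P.map ζ = D) (hind : IndepFun X ζ P) {G : E → S → E}
    (hG : Measurable (fun q : E × S => G q.1 q.2))
    (hsq : ∀ x, Integrable (fun s => ‖G x s‖ ^ 2) D) {σ : ℝ}
    (hle : ∀ x, ∫ s, ‖G x s‖ ^ 2 ∂D ≤ σ ^ 2) :
    MemLp (fun ω => G (X ω) (ζ ω)) 2 P ∧ ∫ ω, ‖G (X ω) (ζ ω)‖ ^ 2 ∂P ≤ σ ^ 2 := by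
  have hmeas : Measurable fun ω => G (X ω) (ζ ω) := hG.comp (hX.prodMk hζ)
  have hprob : IsProbabilityMeasure (P.map X) := Measure.isProbabilityMeasure_map hX.aemeasurable
  have hmap := (indepFun_iff_map_prod_eq_prod_map_map hX.aemeasurable hζ.aemeasurable).1 hind
  have hGsq : Measurable (fun q : E × S => ENNReal.ofReal (‖G q.1 q.2‖ ^ 2)) :=
    (hG.norm.pow_const 2).ennreal_ofReal
  have hl : ∫⁻ ω, ENNReal.ofReal (‖G (X ω) (ζ ω)‖ ^ 2) ∂P ≤ ENNReal.ofReal (σ ^ 2) := by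
    calc ∫⁻ ω, ENNReal.ofReal (‖G (X ω) (ζ ω)‖ ^ 2) ∂P
        = ∫⁻ q, ENNReal.ofReal (‖G q.1 q.2‖ ^ 2) ∂(P.map fun ω => (X ω, ζ ω)) :=
          (lintegral_map hGsq (hX.prodMk hζ)).symm
      _ = ∫⁻ x, ∫⁻ s, ENNReal.ofReal (‖G x s‖ ^ 2) ∂D ∂(P.map X) := by
          rw [hmap, hlaw, lintegral_prod _ hGsq.aemeasurable]
      _ ≤ ∫⁻ _, ENNReal.ofReal (σ ^ 2) ∂(P.map X) := by
          refine lintegral_mono fun x => ?_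
          rw [← ofReal_integral_eq_lintegral_ofReal (hsq x)
            (Filter.Eventually.of_forall fun s => sq_nonneg _)]
          exact ENNReal.ofReal_le_ofReal (hle x)
      _ = ENNReal.ofReal (σ ^ 2) := by simp
  have hint : Integrable (fun ω => ‖G (X ω) (ζ ω)‖ ^ 2) P := by
    refine ⟨(hmeas.norm.pow_const 2).aestronglyMeasurable, ?_⟩
    rw [hasFiniteIntegral_iff_ofReal (Filter.Eventually.of_forall fun ω => sq_nonneg _)]
    exact hl.trans_lt ENNReal.ofReal_lt_top
  refine ⟨(memLp_two_iff_integrable_sq_norm hmeas.aestronglyMeasurable).2 hint, ?_⟩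
  rw [← ENNReal.ofReal_le_ofReal_iff (sq_nonneg σ),
    ofReal_integral_eq_lintegral_ofReal hint (Filter.Eventually.of_forall fun ω => sq_nonneg _)]
  exact hl

variable [InnerProductSpace ℝ E] [CompleteSpace E]

/-- A centred random field evaluated at a random point is orthogonal to everything that, jointly
with this point, is independent of the field. -/
lemma integral_inner_fresh_noise {P : Measure Ω} [IsProbabilityMeasure P] {D : Measure S}
    [IsProbabilityMeasure D] {X Z : Ω → E} {ζ : Ω → S} (hX : Measurable X) (hZ : Measurable Z)
    (hζ : Measurable ζ) (hlaw : P.map ζ = D) (hind : IndepFun (fun ω => (X ω, Z ω)) ζ P)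
    {G : E → S → E} (hG : Measurable (fun q : E × S => G q.1 q.2))
    (hint : ∀ x, Integrable (G x) D) (hzero : ∀ x, ∫ s, G x s ∂D = 0)
    (hGX : MemLp (fun ω => G (X ω) (ζ ω)) 2 P) (hZ2 : MemLp Z 2 P) :
    ∫ ω, inner ℝ (G (X ω) (ζ ω)) (Z ω) ∂P = 0 := by
  have hXZ : Measurable fun ω => (X ω, Z ω) := hX.prodMk hZ
  have hprob : IsProbabilityMeasure (P.map fun ω => (X ω, Z ω)) :=
    Measure.isProbabilityMeasure_map hXZ.aemeasurable
  have hmap := (indepFun_iff_map_prod_eq_prod_map_map hXZ.aemeasurable hζ.aemeasurable).1 hind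
  have hk : Measurable fun q : (E × E) × S => (inner ℝ (G q.1.1 q.2) q.1.2 : ℝ) :=
    (hG.comp ((measurable_fst.comp measurable_fst).prodMk measurable_snd)).inner
      (measurable_snd.comp measurable_fst)
  have hi : Integrable (fun ω => (inner ℝ (G (X ω) (ζ ω)) (Z ω) : ℝ)) P := 
    integrable_inner_of_memLp_two hGX hZ2
  have hi' : Integrable (fun q : (E × E) × S => (inner ℝ (G q.1.1 q.2) q.1.2 : ℝ))
      ((P.map fun ω => (X ω, Z ω)).prod D) := by
    rw [← hlaw, ← hmap, integrable_map_measure hk.aestronglyMeasurable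
      (hXZ.prodMk hζ).aemeasurable]
    exact hi
  calc ∫ ω, inner ℝ (G (X ω) (ζ ω)) (Z ω) ∂P
      = ∫ q, inner ℝ (G q.1.1 q.2) q.1.2 ∂(P.map fun ω => ((X ω, Z ω), ζ ω)) :=
        (integral_map (f := fun q : (E × E) × S => (inner ℝ (G q.1.1 q.2) q.1.2 : ℝ))
          (hXZ.prodMk hζ).aemeasurable hk.aestronglyMeasurable).symm
    _ = ∫ v, ∫ s, inner ℝ (G v.1 s) v.2 ∂D ∂(P.map fun ω => (X ω, Z ω)) := by
        rw [hmap, hlaw, integral_prod _ hi']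
    _ = ∫ v, (0 : ℝ) ∂(P.map fun ω => (X ω, Z ω)) := by
        congr 1
        ext v
        rw [show (fun s => (inner ℝ (G v.1 s) v.2 : ℝ)) = fun s => inner ℝ v.2 (G v.1 s) from
          funext fun s => real_inner_comm _ _, integral_inner (hint _), hzero, inner_zero_right]
    _ = 0 := by simp

end FreshNoise

/-! ### Information carried by samples, and dependence of the iterates on it -/

section Sampling

variable {n : ℕ} {S : Fin n → Type*} [∀ i, MeasurableSpace (S i)] {Ω : Type*}

/-- The information contained in the samples with index in `A`. -/
@[reducible] def sampleInfo (ξ : ℕ → (i : Fin n) → Ω → S i) (A : Set (ℕ × Fin n)) : MeasurableSpace Ω :=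
  ⨆ k ∈ A, MeasurableSpace.comap (ξ k.1 k.2) inferInstance

lemma sampleInfo_mono (ξ : ℕ → (i : Fin n) → Ω → S i) {A A' : Set (ℕ × Fin n)} (h : A ⊆ A') :
    sampleInfo ξ A ≤ sampleInfo ξ A' :=
  biSup_mono fun _ hk => h hk

lemma measurable_sample (ξ : ℕ → (i : Fin n) → Ω → S i) {A : Set (ℕ × Fin n)} {t : ℕ} {i : Fin n}
    (h : (t, i) ∈ A) : Measurable[sampleInfo ξ A] (ξ t i) := by
  have h1 : Measurable[MeasurableSpace.comap (ξ t i) inferInstance] (ξ t i) :=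
    comap_measurable _
  refine h1.mono ?_ le_rfl
  exact le_iSup₂_of_le (f := fun (k : ℕ × Fin n) (_ : k ∈ A) =>
    MeasurableSpace.comap (ξ k.1 k.2) inferInstance) (t, i) h le_rfl

variable [MeasurableSpace Ω] {P : Measure Ω} {D : (i : Fin n) → Measure (S i)}
  {ξ : ℕ → (i : Fin n) → Ω → S i}

lemma sampleInfo_le (hξ : BTPP.IndependentSampling P D ξ) (A : Set (ℕ × Fin n)) :
    sampleInfo ξ A ≤ ‹MeasurableSpace Ω› :=
  iSup₂_le fun k _ => (hξ.measurable k.1 k.2).comap_le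

lemma indepFun_sample (hξ : BTPP.IndependentSampling P D ξ) {A : Set (ℕ × Fin n)} {t : ℕ}
    {i : Fin n} (h : (t, i) ∉ A) {E : Type*} [MeasurableSpace E] {X : Ω → E}
    (hX : Measurable[sampleInfo ξ A] X) : IndepFun X (ξ t i) P := by
  have hi := hξ.indep
  rw [iIndepFun_iff_iIndep] at hi
  have h1 := indep_iSup_of_disjoint (fun k : ℕ × Fin n => (hξ.measurable k.1 k.2).comap_le) hi
    (Set.disjoint_singleton_right.2 h)
  rw [IndepFun_iff_Indep]
  refine indep_of_indep_of_le_left (indep_of_indep_of_le_right h1 ?_) hX.comap_le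
  exact le_iSup₂_of_le (f := fun (k : ℕ × Fin n) (_ : k ∈ ({(t, i)} : Set (ℕ × Fin n))) =>
    MeasurableSpace.comap (ξ k.1 k.2) inferInstance) (t, i) rfl le_rfl

end Sampling

/-- The Push-Pull recursion on a tree, driven by the stochastic gradients `g` and the samples `ξ`. -/
structure StochasticPushPull {p n : ℕ} {S : Fin n → Type*} {Ω : Type*} (𝒯 : ParentTree (Fin n))
    (γ : ℝ) (g : (i : Fin n) → BTPP.Vec p → S i → BTPP.Vec p) (ξ : ℕ → (i : Fin n) → Ω → S i)
    (x0 : BTPP.Vec p) (X Y : ℕ → Fin n → Ω → BTPP.Vec p) : Prop where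
  X_zero : ∀ i, X 0 i = fun _ => x0
  X_succ : ∀ t i, X (t + 1) i = X t (𝒯.par i) - γ • Y t (𝒯.par i)
  Y_zero : ∀ i, Y 0 i = fun ω => g i (X 0 i ω) (ξ 0 i ω)
  Y_succ : ∀ t i, Y (t + 1) i = fun ω => ∑ c with 𝒯.par c = i, Y t c ω
    + g i (X (t + 1) i ω) (ξ (t + 1) i ω) - g i (X t i ω) (ξ t i ω)

/-- The samples whose influence reaches the root before time `τ`. -/
def ParentTree.earlier {n : ℕ} (𝒯 : ParentTree (Fin n)) (τ : ℕ) : Set (ℕ × Fin n) :=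
  {k | k.1 + 𝒯.dep k.2 < τ}

lemma ParentTree.earlier_mono {n : ℕ} (𝒯 : ParentTree (Fin n)) {τ τ' : ℕ} (h : τ ≤ τ') :
    𝒯.earlier τ ⊆ 𝒯.earlier τ' := fun k hk => by
  simp only [ParentTree.earlier, Set.mem_ofPred_eq] at hk ⊢; omega

namespace StochasticPushPull

variable {p n : ℕ} {S : Fin n → Type*} [∀ i, MeasurableSpace (S i)] {Ω : Type*}
  {𝒯 : ParentTree (Fin n)} {γ σ L : ℝ} {f : Fin n → BTPP.Vec p → ℝ}
  {g : (i : Fin n) → BTPP.Vec p → S i → BTPP.Vec p} {ξ : ℕ → (i : Fin n) → Ω → S i}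
  {x0 : BTPP.Vec p} {X Y : ℕ → Fin n → Ω → BTPP.Vec p}

/-- Iterates use strictly earlier clocks, trackers also the current one. Pulling from the parent
respects this, as the parent is no deeper; pushing does too, as `(t, c)` for a child `c` has the
same clock as `(t + 1, i)`. -/
lemma measurable_aux (h : StochasticPushPull 𝒯 γ g ξ x0 X Y)
    (hg : ∀ i, Measurable (fun q : BTPP.Vec p × S i => g i q.1 q.2)) (t : ℕ) :
    ∀ i, Measurable[sampleInfo ξ (𝒯.earlier (t + 𝒯.dep i))] (X t i) ∧
      Measurable[sampleInfo ξ (𝒯.earlier (t + 𝒯.dep i + 1))] (Y t i) := by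
  have hgx : ∀ t i, Measurable[sampleInfo ξ (𝒯.earlier (t + 𝒯.dep i))] (X t i) →
      Measurable[sampleInfo ξ (𝒯.earlier (t + 𝒯.dep i + 1))]
        (fun ω => g i (X t i ω) (ξ t i ω)) := by
    intro t i hX
    have h1 := hX.mono (sampleInfo_mono ξ (𝒯.earlier_mono (Nat.le_succ (t + 𝒯.dep i)))) le_rfl
    have h2 : Measurable[sampleInfo ξ (𝒯.earlier (t + 𝒯.dep i + 1))] (ξ t i) :=
      measurable_sample ξ (by simp [ParentTree.earlier])
    exact (hg i).comp (h1.prodMk h2)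
  induction t with
  | zero =>
    intro i
    have hX : Measurable[sampleInfo ξ (𝒯.earlier (0 + 𝒯.dep i))] (X 0 i) := by
      rw [h.X_zero]; exact measurable_const
    refine ⟨hX, ?_⟩
    rw [h.Y_zero]
    exact hgx 0 i hX
  | succ t ih =>
    intro i
    have hX : Measurable[sampleInfo ξ (𝒯.earlier (t + 1 + 𝒯.dep i))] (X (t + 1) i) := by
      have hd := 𝒯.dep_par i
      have h1 := (ih (𝒯.par i)).1.mono (sampleInfo_mono ξ (𝒯.earlier_mono
        (show t + 𝒯.dep (𝒯.par i) ≤ t + 1 + 𝒯.dep i by omega))) le_rfl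
      have h2 := (ih (𝒯.par i)).2.mono (sampleInfo_mono ξ (𝒯.earlier_mono
        (show t + 𝒯.dep (𝒯.par i) + 1 ≤ t + 1 + 𝒯.dep i by omega))) le_rfl
      rw [h.X_succ]
      exact h1.sub (h2.const_smul γ)
    refine ⟨hX, ?_⟩
    rw [h.Y_succ]
    have h1 := hgx (t + 1) i hX
    have h2 := (hgx t i (ih i).1).mono (sampleInfo_mono ξ (𝒯.earlier_mono
        (show t + 𝒯.dep i + 1 ≤ t + 1 + 𝒯.dep i + 1 by omega))) le_rfl
    refine (Measurable.add (Finset.measurable_fun_sum _ fun c hc => ?_) h1).sub h2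
    rw [Finset.mem_filter] at hc
    have hd := 𝒯.dep_par c
    rw [hc.2] at hd
    exact (ih c).2.mono (sampleInfo_mono ξ (𝒯.earlier_mono (by omega))) le_rfl

/-- The deviation of the stochastic gradient of agent `i` at iteration `t` from its mean. -/
def noise (f : Fin n → BTPP.Vec p → ℝ) (g : (i : Fin n) → BTPP.Vec p → S i → BTPP.Vec p)
    (ξ : ℕ → (i : Fin n) → Ω → S i) (X : ℕ → Fin n → Ω → BTPP.Vec p) (t : ℕ) (i : Fin n) (ω : Ω) :
    BTPP.Vec p :=
  g i (X t i ω) (ξ t i ω) - gradient (f i) (X t i ω)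

lemma measurable_X (h : StochasticPushPull 𝒯 γ g ξ x0 X Y)
    (hg : ∀ i, Measurable (fun q : BTPP.Vec p × S i => g i q.1 q.2))
    {t τ : ℕ} {i : Fin n} (hτ : t + 𝒯.dep i ≤ τ) :
    Measurable[sampleInfo ξ (𝒯.earlier τ)] (X t i) :=
  (h.measurable_aux hg t i).1.mono (sampleInfo_mono ξ (𝒯.earlier_mono hτ)) le_rfl

lemma continuous_gradient (hsmooth : BTPP.SmoothBelow f L) (i : Fin n) :
    Continuous (gradient (f i)) := by
  refine (LipschitzWith.of_dist_le_mul (K := L.toNNReal) fun x x' => ?_).continuous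
  rw [dist_eq_norm, dist_eq_norm, Real.coe_toNNReal']
  exact (hsmooth.lipschitz i x x').trans (by gcongr; exact le_max_left _ _)

variable {D : (i : Fin n) → Measure (S i)}

lemma measurable_centred (hvar : BTPP.UnbiasedBoundedVariance f g D σ)
    (hsmooth : BTPP.SmoothBelow f L) (i : Fin n) :
    Measurable (fun q : BTPP.Vec p × S i => g i q.1 q.2 - gradient (f i) q.1) :=
  (hvar.measurable i).sub ((continuous_gradient hsmooth i).measurable.comp measurable_fst)

lemma measurable_noise (h : StochasticPushPull 𝒯 γ g ξ x0 X Y)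
    (hvar : BTPP.UnbiasedBoundedVariance f g D σ) (hsmooth : BTPP.SmoothBelow f L)
    {t : ℕ} {i : Fin n} {A : Set (ℕ × Fin n)} (hA : 𝒯.earlier (t + 𝒯.dep i) ⊆ A)
    (hti : (t, i) ∈ A) : Measurable[sampleInfo ξ A] (noise f g ξ X t i) := by
  have h1 := (h.measurable_X hvar.measurable (le_refl (t + 𝒯.dep i))).mono
    (sampleInfo_mono ξ hA) le_rfl
  exact (measurable_centred hvar hsmooth i).comp (h1.prodMk (measurable_sample ξ hti))

variable [MeasurableSpace Ω] {P : Measure Ω} [IsProbabilityMeasure P]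

lemma memLp_gradient (hsmooth : BTPP.SmoothBelow f L) (i : Fin n)
    {Z : Ω → BTPP.Vec p} (hZ : MemLp Z 2 P) : MemLp (fun ω => gradient (f i) (Z ω)) 2 P := by
  have h0 : MemLp (fun ω => ‖gradient (f i) 0‖ + L * ‖Z ω‖) 2 P :=
    MemLp.add (f := fun _ => ‖gradient (f i) 0‖) (g := fun ω => L * ‖Z ω‖)
      (memLp_const _) (hZ.norm.const_mul L)
  refine h0.mono' ((continuous_gradient hsmooth i).comp_aestronglyMeasurable hZ.1)
    (Filter.Eventually.of_forall fun ω => ?_)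
  have h1 := hsmooth.lipschitz i (Z ω) 0
  have h2 := norm_sub_norm_le (gradient (f i) (Z ω)) (gradient (f i) 0)
  rw [sub_zero] at h1
  linarith

variable [∀ i, IsProbabilityMeasure (D i)]

lemma noise_memLp (h : StochasticPushPull 𝒯 γ g ξ x0 X Y)
    (hvar : BTPP.UnbiasedBoundedVariance f g D σ) (hξ : BTPP.IndependentSampling P D ξ)
    (hsmooth : BTPP.SmoothBelow f L) (t : ℕ) (i : Fin n) :
    MemLp (noise f g ξ X t i) 2 P ∧ ∫ ω, ‖noise f g ξ X t i ω‖ ^ 2 ∂P ≤ σ ^ 2 := by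
  have hX := h.measurable_X hvar.measurable (le_refl (t + 𝒯.dep i))
  exact memLp_fresh_noise (hX.mono (sampleInfo_le hξ _) le_rfl) (hξ.measurable t i) (hξ.law t i)
    (indepFun_sample hξ (by simp [ParentTree.earlier]) hX)
    (measurable_centred hvar hsmooth i) (hvar.integrable_sq i) (hvar.variance_le i)

/-- The index set `A` is left free so that other samples with the same clock can be adjoined to the
past. -/
lemma integral_inner_noise (h : StochasticPushPull 𝒯 γ g ξ x0 X Y)
    (hvar : BTPP.UnbiasedBoundedVariance f g D σ) (hξ : BTPP.IndependentSampling P D ξ)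
    (hsmooth : BTPP.SmoothBelow f L) (t : ℕ) (i : Fin n) {A : Set (ℕ × Fin n)}
    (hA : 𝒯.earlier (t + 𝒯.dep i) ⊆ A) (hti : (t, i) ∉ A) {Z : Ω → BTPP.Vec p}
    (hZ : Measurable[sampleInfo ξ A] Z) (hZ2 : MemLp Z 2 P) :
    ∫ ω, inner ℝ (noise f g ξ X t i ω) (Z ω) ∂P = 0 := by
  have hX := (h.measurable_X hvar.measurable (le_refl (t + 𝒯.dep i))).mono
    (sampleInfo_mono ξ hA) le_rfl
  refine integral_inner_fresh_noise (hX.mono (sampleInfo_le hξ _) le_rfl)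
    (hZ.mono (sampleInfo_le hξ _) le_rfl) (hξ.measurable t i) (hξ.law t i)
    (indepFun_sample hξ hti (hX.prodMk hZ))
    (measurable_centred hvar hsmooth i) (fun x => (hvar.integrable i x).sub (integrable_const _))
    (fun x => ?_) (h.noise_memLp hvar hξ hsmooth t i).1 hZ2
  refine (integral_sub (hvar.integrable i x) (integrable_const (gradient (f i) x))).trans ?_
  rw [hvar.unbiased]
  simp

lemma memLp_aux (h : StochasticPushPull 𝒯 γ g ξ x0 X Y)
    (hvar : BTPP.UnbiasedBoundedVariance f g D σ) (hξ : BTPP.IndependentSampling P D ξ)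
    (hsmooth : BTPP.SmoothBelow f L) (t : ℕ) :
    ∀ i, MemLp (X t i) 2 P ∧ MemLp (Y t i) 2 P := by
  have hgx : ∀ t i, MemLp (X t i) 2 P → MemLp (fun ω => g i (X t i ω) (ξ t i ω)) 2 P := by
    intro t i hX
    have := (h.noise_memLp hvar hξ hsmooth t i).1.add (memLp_gradient hsmooth i hX)
    convert this using 1
    ext1 ω
    simp [noise]
  induction t with
  | zero =>
    intro i
    have hX : MemLp (X 0 i) 2 P := by rw [h.X_zero]; exact memLp_const _
    exact ⟨hX, by rw [h.Y_zero]; exact hgx 0 i hX⟩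
  | succ t ih =>
    intro i
    have hX : MemLp (X (t + 1) i) 2 P := by
      rw [h.X_succ]
      exact (ih _).1.sub ((ih _).2.const_smul γ)
    refine ⟨hX, ?_⟩
    rw [h.Y_succ]
    exact ((memLp_finsetSum _ fun c _ => (ih c).2).add (hgx _ i hX)).sub (hgx t i (ih i).1)

end StochasticPushPull

/-! ### Passage to the Hilbert space L² -/

lemma inner_toLp_two {Ω E : Type*} [MeasurableSpace Ω] [NormedAddCommGroup E]
    [InnerProductSpace ℝ E] {P : Measure Ω} {X Z : Ω → E} (hX : MemLp X 2 P) (hZ : MemLp Z 2 P) :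
    inner ℝ (hX.toLp X) (hZ.toLp Z) = ∫ ω, (inner ℝ (X ω) (Z ω) : ℝ) ∂P := by
  rw [L2.inner_def]
  refine integral_congr_ae ?_
  filter_upwards [hX.coeFn_toLp, hZ.coeFn_toLp] with ω h1 h2
  rw [h1, h2]

lemma norm_toLp_two_sq {Ω E : Type*} [MeasurableSpace Ω] [NormedAddCommGroup E]
    [InnerProductSpace ℝ E] {P : Measure Ω} {X : Ω → E} (hX : MemLp X 2 P) :
    ‖hX.toLp X‖ ^ 2 = ∫ ω, ‖X ω‖ ^ 2 ∂P := by
  rw [← real_inner_self_eq_norm_sq, inner_toLp_two]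
  simp only [real_inner_self_eq_norm_sq]

lemma norm_sq_Lp_two {Ω E : Type*} [MeasurableSpace Ω] [NormedAddCommGroup E]
    [InnerProductSpace ℝ E] {P : Measure Ω} (z : Lp E 2 P) : ‖z‖ ^ 2 = ∫ ω, ‖z ω‖ ^ 2 ∂P := by
  rw [← real_inner_self_eq_norm_sq, L2.inner_def]
  simp only [real_inner_self_eq_norm_sq]

namespace StochasticPushPull

variable {p n : ℕ} {S : Fin n → Type*} [∀ i, MeasurableSpace (S i)] {Ω : Type*}
  {𝒯 : ParentTree (Fin n)} {γ σ L μ : ℝ} {f : Fin n → BTPP.Vec p → ℝ}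
  {g : (i : Fin n) → BTPP.Vec p → S i → BTPP.Vec p} {ξ : ℕ → (i : Fin n) → Ω → S i}
  {x0 xs : BTPP.Vec p} {X Y : ℕ → Fin n → Ω → BTPP.Vec p}
  [MeasurableSpace Ω] {P : Measure Ω} [IsProbabilityMeasure P]

/-- The gradient of `f i`, acting on square integrable random vectors. -/
def gradientLp (P : Measure Ω) [IsProbabilityMeasure P] (hsmooth : BTPP.SmoothBelow f L)
    (i : Fin n) (z : Lp (BTPP.Vec p) 2 P) : Lp (BTPP.Vec p) 2 P :=
  (memLp_gradient hsmooth i (Lp.memLp z)).toLp _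

lemma coeFn_gradientLp (hsmooth : BTPP.SmoothBelow f L) (i : Fin n) (z : Lp (BTPP.Vec p) 2 P) :
    gradientLp P hsmooth i z =ᵐ[P] fun ω => gradient (f i) (z ω) :=
  MemLp.coeFn_toLp _

lemma gradientLp_toLp (hsmooth : BTPP.SmoothBelow f L) (i : Fin n) {Z : Ω → BTPP.Vec p}
    (hZ : MemLp Z 2 P) :
    gradientLp P hsmooth i (hZ.toLp Z) = (memLp_gradient hsmooth i hZ).toLp _ := by
  refine MemLp.toLp_congr _ _ ?_
  filter_upwards [hZ.coeFn_toLp] with ω h1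
  rw [h1]

lemma gradientLp_const (hsmooth : BTPP.SmoothBelow f L) (i : Fin n) (z : BTPP.Vec p) :
    gradientLp P hsmooth i (Lp.const 2 P z) = Lp.const 2 P (gradient (f i) z) := by
  rw [← MemLp.toLp_const, gradientLp_toLp, ← MemLp.toLp_const]

lemma gradientLp_lipschitz (hsmooth : BTPP.SmoothBelow f L) (i : Fin n)
    (z z' : Lp (BTPP.Vec p) 2 P) :
    ‖gradientLp P hsmooth i z - gradientLp P hsmooth i z'‖ ≤ L * ‖z - z'‖ := by
  refine Lp.norm_le_mul_norm_of_ae_le_mul ?_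
  filter_upwards [coeFn_gradientLp hsmooth i z, coeFn_gradientLp hsmooth i z',
    Lp.coeFn_sub z z', Lp.coeFn_sub (gradientLp P hsmooth i z) (gradientLp P hsmooth i z')]
    with ω h1 h2 h3 h4
  rw [h3, h4, Pi.sub_apply, Pi.sub_apply, h1, h2]
  exact hsmooth.lipschitz i _ _

lemma gradientLp_strongly_monotone (hsmooth : BTPP.SmoothBelow f L)
    (hmono : ∀ z, n * μ * ‖z - xs‖ ^ 2 ≤ inner ℝ (∑ i, gradient (f i) z) (z - xs))
    (z : Lp (BTPP.Vec p) 2 P) :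
    n * μ * ‖z - Lp.const 2 P xs‖ ^ 2 ≤
      inner ℝ (∑ i, gradientLp P hsmooth i z) (z - Lp.const 2 P xs) := by
  rw [norm_sq_Lp_two, L2.inner_def, ← integral_const_mul]
  refine integral_mono_ae ?_ (L2.integrable_inner _ _) ?_
  · exact ((memLp_two_iff_integrable_sq_norm (Lp.memLp (z - Lp.const 2 P xs)).1).1
      (Lp.memLp (z - Lp.const 2 P xs))).const_mul _
  · have hall : ∀ᵐ ω ∂P, ∀ i, gradientLp P hsmooth i z ω = gradient (f i) (z ω) :=
      ae_all_iff.2 fun i => coeFn_gradientLp hsmooth i z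
    filter_upwards [hall, Lp.coeFn_fun_finsetSum Finset.univ fun i => gradientLp P hsmooth i z,
      Lp.coeFn_sub z (Lp.const 2 P xs), Lp.coeFn_const 2 P xs] with ω h1 h2 h3 h4
    rw [h2, h3, Pi.sub_apply, h4, Finset.sum_congr rfl fun i _ => h1 i]
    exact hmono (z ω)

variable {D : (i : Fin n) → Measure (S i)} [∀ i, IsProbabilityMeasure (D i)]

lemma treePushPull (h : StochasticPushPull 𝒯 γ g ξ x0 X Y)
    (hvar : BTPP.UnbiasedBoundedVariance f g D σ) (hξ : BTPP.IndependentSampling P D ξ)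
    (hsmooth : BTPP.SmoothBelow f L) {d : ℕ} (hdep : ∀ i, 𝒯.dep i ≤ d)
    (hzero : ∑ i, gradient (f i) xs = 0)
    (hmono : ∀ z, n * μ * ‖z - xs‖ ^ 2 ≤ inner ℝ (∑ i, gradient (f i) z) (z - xs)) :
    TreePushPull 𝒯 γ L μ σ d (gradientLp P hsmooth)
      (fun t i => (h.noise_memLp hvar hξ hsmooth t i).1.toLp _)
      (fun t i => (h.memLp_aux hvar hξ hsmooth t i).1.toLp _)
      (fun t i => (h.memLp_aux hvar hξ hsmooth t i).2.toLp _)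
      (Lp.const 2 P x0) (Lp.const 2 P xs) := by
  have hgrad : ∀ t i, ∀ᵐ ω ∂P, gradientLp P hsmooth i
      ((h.memLp_aux hvar hξ hsmooth t i).1.toLp _) ω = gradient (f i) (X t i ω) := fun t i => by
    rw [gradientLp_toLp]; exact MemLp.coeFn_toLp _
  refine ⟨hdep, fun i => ?_, fun t i => ?_, fun i => ?_, fun t i => ?_,
    gradientLp_lipschitz hsmooth, ?_, ?_, fun t i => ?_, fun τ i j hij => ?_, fun τ j => ?_,
    fun τ j i => ?_⟩
  · rw [← MemLp.toLp_const]
    exact MemLp.toLp_congr _ _ (by rw [h.X_zero])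
  · rw [← MemLp.toLp_const_smul, ← MemLp.toLp_sub]
    exact MemLp.toLp_congr _ _ (by rw [h.X_succ])
  · refine Lp.ext ?_
    filter_upwards [MemLp.coeFn_toLp (h.memLp_aux hvar hξ hsmooth 0 i).2, hgrad 0 i,
      MemLp.coeFn_toLp (h.noise_memLp hvar hξ hsmooth 0 i).1,
      Lp.coeFn_add (gradientLp P hsmooth i ((h.memLp_aux hvar hξ hsmooth 0 i).1.toLp _))
        ((h.noise_memLp hvar hξ hsmooth 0 i).1.toLp _)] with ω h1 h2 h3 h4
    rw [h1, h4, Pi.add_apply, h2, h3, h.Y_zero]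
    simp [noise]
  · refine Lp.ext ?_
    have hall : ∀ᵐ ω ∂P, ∀ c, (h.memLp_aux hvar hξ hsmooth t c).2.toLp _ ω = Y t c ω :=
      ae_all_iff.2 fun c => MemLp.coeFn_toLp _
    filter_upwards [MemLp.coeFn_toLp (h.memLp_aux hvar hξ hsmooth (t + 1) i).2, hgrad (t + 1) i,
      hgrad t i, MemLp.coeFn_toLp (h.noise_memLp hvar hξ hsmooth (t + 1) i).1,
      MemLp.coeFn_toLp (h.noise_memLp hvar hξ hsmooth t i).1, hall,
      Lp.coeFn_fun_finsetSum (Finset.univ.filter fun c => 𝒯.par c = i)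
        fun c => (h.memLp_aux hvar hξ hsmooth t c).2.toLp _,
      Lp.coeFn_add (gradientLp P hsmooth i ((h.memLp_aux hvar hξ hsmooth t i).1.toLp _))
        ((h.noise_memLp hvar hξ hsmooth t i).1.toLp _),
      Lp.coeFn_add (gradientLp P hsmooth i ((h.memLp_aux hvar hξ hsmooth (t + 1) i).1.toLp _))
        ((h.noise_memLp hvar hξ hsmooth (t + 1) i).1.toLp _),
      Lp.coeFn_add (∑ c with 𝒯.par c = i, (h.memLp_aux hvar hξ hsmooth t c).2.toLp _)
        (gradientLp P hsmooth i ((h.memLp_aux hvar hξ hsmooth (t + 1) i).1.toLp _)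
          + (h.noise_memLp hvar hξ hsmooth (t + 1) i).1.toLp _),
      Lp.coeFn_sub (∑ c with 𝒯.par c = i, (h.memLp_aux hvar hξ hsmooth t c).2.toLp _
        + (gradientLp P hsmooth i ((h.memLp_aux hvar hξ hsmooth (t + 1) i).1.toLp _)
          + (h.noise_memLp hvar hξ hsmooth (t + 1) i).1.toLp _))
        (gradientLp P hsmooth i ((h.memLp_aux hvar hξ hsmooth t i).1.toLp _)
          + (h.noise_memLp hvar hξ hsmooth t i).1.toLp _)]
      with ω h1 h2 h3 h4 h5 h6 h7 h8 h9 h10 h11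
    rw [h1, h11, Pi.sub_apply, h10, Pi.add_apply, h9, h8, Pi.add_apply, Pi.add_apply, h7, h2, h3,
      h4, h5, Finset.sum_congr rfl fun c _ => h6 c, h.Y_succ]
    simp [noise]
  · simp only [gradientLp_const]
    rw [← map_sum, hzero, map_zero]
  · intro z
    rw [Fintype.card_fin]
    exact gradientLp_strongly_monotone hsmooth hmono z
  · rw [norm_toLp_two_sq]
    exact (h.noise_memLp hvar hξ hsmooth t i).2
  · unfold ParentTree.arrival
    split_ifs with hi hj
    · rw [real_inner_comm, inner_toLp_two]
      have ei : τ - 𝒯.dep i + 𝒯.dep i = τ := Nat.sub_add_cancel hi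
      have ej : τ - 𝒯.dep j + 𝒯.dep j = τ := Nat.sub_add_cancel hj
      -- The sample behind the noise of `i` is added to the past; the sample of `j`, having the same
      -- clock but another agent, remains outside.
      refine h.integral_inner_noise hvar hξ hsmooth (τ - 𝒯.dep j) j
        (A := insert (τ - 𝒯.dep i, i) (𝒯.earlier τ)) ?_ ?_ ?_
        (h.noise_memLp hvar hξ hsmooth _ _).1
      · rw [ej]; exact Set.subset_insert _ _
      · simp [ParentTree.earlier, ej, hij.symm]
      · refine h.measurable_noise hvar hsmooth ?_ (Set.mem_insert _ _)
        rw [ei]; exact Set.subset_insert _ _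
    all_goals simp
  · unfold ParentTree.arrival
    split_ifs with hj
    · have ej : τ - 𝒯.dep j + 𝒯.dep j = τ := Nat.sub_add_cancel hj
      rw [← MemLp.toLp_const, ← MemLp.toLp_sub, inner_toLp_two]
      refine h.integral_inner_noise hvar hξ hsmooth (τ - 𝒯.dep j) j (A := 𝒯.earlier τ)
        (by rw [ej]) (by simp [ParentTree.earlier, ej]) ?_
        ((h.memLp_aux hvar hξ hsmooth _ _).1.sub (memLp_const _))
      exact (h.measurable_X hvar.measurable (by rw [𝒯.dep_root, add_zero])).sub measurable_const
    · simp
  · unfold ParentTree.arrival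
    split_ifs with hj hi
    · have ei : τ - 𝒯.dep i + 𝒯.dep i = τ := Nat.sub_add_cancel hi
      have ej : τ - 𝒯.dep j + 𝒯.dep j = τ := Nat.sub_add_cancel hj
      beta_reduce
      rw [gradientLp_toLp, inner_toLp_two]
      refine h.integral_inner_noise hvar hξ hsmooth (τ - 𝒯.dep j) j (A := 𝒯.earlier τ)
        (by rw [ej]) (by simp [ParentTree.earlier, ej]) ?_
        (memLp_gradient hsmooth i (h.memLp_aux hvar hξ hsmooth _ _).1)
      exact (continuous_gradient hsmooth i).measurable.comp
        (h.measurable_X hvar.measurable ei.le)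
    all_goals simp

/-- Mean squared error of the root's iterate under the stochastic Push-Pull recursion on a tree. -/
theorem root_mean_sq_error (h : StochasticPushPull 𝒯 γ g ξ x0 X Y)
    (hvar : BTPP.UnbiasedBoundedVariance f g D σ) (hξ : BTPP.IndependentSampling P D ξ)
    (hsmooth : BTPP.SmoothBelow f L) {d : ℕ} (hdep : ∀ i, 𝒯.dep i ≤ d)
    (hzero : ∑ i, gradient (f i) xs = 0)
    (hmono : ∀ z, n * μ * ‖z - xs‖ ^ 2 ≤ inner ℝ (∑ i, gradient (f i) z) (z - xs))
    (hd : 1 ≤ d) (hγ : 0 < γ) (hμ : 0 < μ) (hμL : μ ≤ L) (hσ : 0 ≤ σ)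
    (hstep : 100 * n * d ^ 2 * L ^ 2 * γ ≤ μ) {T : ℕ} (hT : 2 * d ≤ T) :
    Integrable (fun ω => ‖X T 𝒯.root ω - xs‖ ^ 2) P ∧
    ∫ ω, ‖X T 𝒯.root ω - xs‖ ^ 2 ∂P ≤
      Real.exp (-(γ * n * μ * T / 8)) *
        (‖x0 - xs‖ ^ 2 + 1 / (n * L ^ 2) * BTPP.gradFrobeniusSq f (fun _ => x0))
        + 3 * γ * σ ^ 2 / μ := by
  have hL : 0 < L := hμ.trans_le hμL
  have hn : (0 : ℝ) < n := by exact_mod_cast (Nat.zero_le _).trans_lt 𝒯.root.isLt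
  have hcard : (Fintype.card (Fin n) : ℝ) = n := by rw [Fintype.card_fin]
  have hmem := (h.memLp_aux hvar hξ hsmooth T 𝒯.root).1
  have hmem' : MemLp (fun ω => X T 𝒯.root ω - xs) 2 P := hmem.sub (memLp_const xs)
  refine ⟨(memLp_two_iff_integrable_sq_norm hmem'.1).1 hmem', ?_⟩
  obtain ⟨Q, hQ⟩ : ∃ Q, Q = BTPP.gradFrobeniusSq f (fun _ => x0) := ⟨_, rfl⟩
  have hQ0 : 0 ≤ Q := by rw [hQ]; exact Finset.sum_nonneg fun i _ => sq_nonneg _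
  have hconst : ∀ z : BTPP.Vec p, ‖Lp.const 2 P z‖ = ‖z‖ := fun z => by
    rw [Lp.norm_const 2 P z (by norm_num)]; simp
  -- `G` is chosen so that `G ^ 2` is the gradient term of the bound; Cauchy–Schwarz over the agents
  -- gives the inequality.
  have hG : ∑ i, ‖gradientLp P hsmooth i (Lp.const 2 P x0)‖ ≤
      Fintype.card (Fin n) * (L * √(1 / (n * L ^ 2) * Q)) := by
    simp only [gradientLp_const, hconst]
    rw [hcard]
    refine abs_le_of_sq_le_sq' ?_ (by positivity) |>.2
    have h1 := sq_sum_le_card_mul_sum_sq (s := Finset.univ) (f := fun i => ‖gradient (f i) x0‖)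
    rw [Finset.card_univ, hcard] at h1
    rw [mul_pow, mul_pow, Real.sq_sqrt (by positivity)]
    refine h1.trans (le_of_eq ?_)
    rw [hQ, BTPP.gradFrobeniusSq]
    field_simp
  have hmain := (h.treePushPull hvar hξ hsmooth hdep hzero hmono).root_error hd hγ hμ hμL hσ
    (Real.sqrt_nonneg _) hG (by rw [hcard]; exact hstep) hT
  rw [← MemLp.toLp_const, ← MemLp.toLp_sub, norm_toLp_two_sq, hcard, MemLp.toLp_const, ← map_sub,
    hconst, Real.sq_sqrt (by positivity), hQ] at hmain
  exact hmain

end StochasticPushPull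

/-! ### The layer-by-layer `B`-ary tree -/

/-- The depth of node `i` of the `B`-ary tree in which node `i + 1` is a child of node `i / B`. -/
def heapDepth (B : ℕ) : ℕ → ℕ
  | 0 => 0
  | i + 1 => heapDepth B (i / B) + 1
termination_by i => i
decreasing_by exact Nat.lt_succ_of_le (Nat.div_le_self i B)

/-- The sizes satisfy 1 + B + … + B^(m+1) = 1 + B(1 + … + B^m), so dividing the shifted index by `B`
moves up one layer. -/
lemma heapDepth_le {B : ℕ} (m i : ℕ) (h : i < ∑ k ∈ Finset.range (m + 1), B ^ k) :
    heapDepth B i ≤ m := by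
  induction m generalizing i with
  | zero =>
    have : i = 0 := by simpa using h
    rw [this, heapDepth]
  | succ m ih =>
    rcases i with _ | i
    · rw [heapDepth]; omega
    · rw [heapDepth]
      have hlt : i / B < ∑ k ∈ Finset.range (m + 1), B ^ k := by
        refine Nat.div_lt_of_lt_mul ?_
        rw [Finset.sum_range_succ', pow_zero] at h
        simp only [pow_succ] at h
        rw [← Finset.sum_mul, mul_comm] at h
        omega
      have := ih _ hlt
      omega

/-- The `B`-ary tree on `n` nodes, filled layer by layer. -/
def heapTree (B n : ℕ) (hn : 0 < n) : ParentTree (Fin n) where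
  root := ⟨0, hn⟩
  par i := ⟨(i - 1) / B, (Nat.div_le_self _ _).trans_lt (by omega)⟩
  dep i := heapDepth B i
  par_root := by simp
  dep_root := by simp [heapDepth]
  dep_eq i hi := by
    obtain ⟨i, hlt⟩ := i
    rcases i with _ | i
    · exact absurd rfl hi
    · simp [heapDepth]

/-- Truncated subtraction sends node 0 to itself, matching the second alternative in the matrix. -/
lemma pullMatrix_eq {B n : ℕ} (hB : 0 < B) (hn : 0 < n) (i j : Fin n) :
    BTPP.pullMatrix B n i j = if (heapTree B n hn).par i = j then 1 else 0 := by
  unfold BTPP.pullMatrix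
  refine if_congr ?_ rfl rfl
  rw [Fin.ext_iff]
  simp only [heapTree]
  rw [Nat.div_eq_iff hB]
  rcases Nat.eq_zero_or_pos j.val with hj | hj
  · rw [hj]; simp; omega
  · have : 0 < B * j.val := Nat.mul_pos hB hj
    rw [mul_comm j.val B]
    omega

lemma iterates_stochasticPushPull {p n : ℕ} {S : Fin n → Type*} {Ω : Type*} {B : ℕ} (hB : 0 < B)
    (hn : 0 < n) (γ : ℝ) (g : (i : Fin n) → BTPP.Vec p → S i → BTPP.Vec p) (x0 : BTPP.Vec p)
    (ξ : ℕ → (i : Fin n) → Ω → S i) :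
    StochasticPushPull (heapTree B n hn) γ g ξ x0
      (fun t i ω => (BTPP.iterates B γ g x0 (fun t i => ξ t i ω) t).1 i)
      (fun t i ω => (BTPP.iterates B γ g x0 (fun t i => ξ t i ω) t).2 i) := by
  have hX : ∀ t i ω, (BTPP.iterates B γ g x0 (fun t i => ξ t i ω) (t + 1)).1 i =
      ∑ j, BTPP.pullMatrix B n i j • ((BTPP.iterates B γ g x0 (fun t i => ξ t i ω) t).1 j
        - γ • (BTPP.iterates B γ g x0 (fun t i => ξ t i ω) t).2 j) := fun t i ω => rfl
  refine ⟨fun i => rfl, fun t i => ?_, fun i => rfl, fun t i => ?_⟩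
  · ext1 ω
    beta_reduce
    rw [hX]
    simp [pullMatrix_eq hB hn]
  · ext1 ω
    have hY : (BTPP.iterates B γ g x0 (fun t i => ξ t i ω) (t + 1)).2 i =
        ∑ j, BTPP.pushMatrix B n i j • (BTPP.iterates B γ g x0 (fun t i => ξ t i ω) t).2 j
          + g i ((BTPP.iterates B γ g x0 (fun t i => ξ t i ω) (t + 1)).1 i) (ξ (t + 1) i ω)
          - g i ((BTPP.iterates B γ g x0 (fun t i => ξ t i ω) t).1 i) (ξ t i ω) := rfl
    beta_reduce
    rw [hY]
    simp [BTPP.pushMatrix, pullMatrix_eq hB hn, Finset.sum_filter]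

/-! ### The averaged objective -/

section Objective

variable {p n : ℕ} {f : Fin n → BTPP.Vec p → ℝ} {L μ : ℝ} {xs : BTPP.Vec p}

lemma gradient_avgObjective (hdiff : ∀ i, Differentiable ℝ (f i)) (z : BTPP.Vec p) :
    gradient (BTPP.avgObjective f) z = (1 / (n : ℝ)) • ∑ i, gradient (f i) z := by
  have h1 : HasFDerivAt (BTPP.avgObjective f) ((1 / (n : ℝ)) • ∑ i, fderiv ℝ (f i) z) z :=
    (HasFDerivAt.fun_sum fun i _ => (hdiff i z).hasFDerivAt).const_mul (1 / (n : ℝ))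
  rw [gradient, h1.fderiv]
  simp [gradient, map_sum]

lemma sum_gradient_eq_zero (hn : 0 < n) (hsmooth : BTPP.SmoothBelow f L)
    (hxs : IsMinOn (BTPP.avgObjective f) Set.univ xs) : ∑ i, gradient (f i) xs = 0 := by
  have h0 : gradient (BTPP.avgObjective f) xs = 0 := by
    rw [gradient, (hxs.isLocalMin Filter.univ_mem).fderiv_eq_zero, map_zero]
  rw [gradient_avgObjective hsmooth.differentiable] at h0
  have : (1 / (n : ℝ)) ≠ 0 := by positivity
  exact (smul_eq_zero.1 h0).resolve_left this

/-- Add the strong convexity inequalities at `(xs, z)` and `(z, xs)`; the gradient at the minimizer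
vanishes. -/
lemma sum_gradient_strongly_monotone (hn : 0 < n) (hsmooth : BTPP.SmoothBelow f L)
    (hconv : BTPP.GradStronglyConvex (BTPP.avgObjective f) μ)
    (hxs : IsMinOn (BTPP.avgObjective f) Set.univ xs) (z : BTPP.Vec p) :
    n * μ * ‖z - xs‖ ^ 2 ≤ inner ℝ (∑ i, gradient (f i) z) (z - xs) := by
  have hn' : (0 : ℝ) < n := by exact_mod_cast hn
  have h1 := hconv xs z
  have h2 := hconv z xs
  rw [gradient_avgObjective hsmooth.differentiable, sum_gradient_eq_zero hn hsmooth hxs, smul_zero,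
    inner_zero_left] at h1
  rw [gradient_avgObjective hsmooth.differentiable, norm_sub_rev, ← neg_sub z xs, inner_neg_right,
    inner_smul_left] at h2
  simp only [RCLike.conj_to_real] at h2
  have h3 : μ * ‖z - xs‖ ^ 2 ≤ 1 / n * inner ℝ (∑ i, gradient (f i) z) (z - xs) := by linarith
  have h4 := mul_le_mul_of_nonneg_left h3 hn'.le
  rw [← mul_assoc, ← mul_assoc, mul_one_div_cancel hn'.ne', one_mul] at h4
  exact h4

lemma strong_convexity_le_smoothness [Nontrivial (BTPP.Vec p)] (hn : 0 < n)
    (hsmooth : BTPP.SmoothBelow f L)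
    (hconv : BTPP.GradStronglyConvex (BTPP.avgObjective f) μ)
    (hxs : IsMinOn (BTPP.avgObjective f) Set.univ xs) : μ ≤ L := by
  have hn' : (0 : ℝ) < n := by exact_mod_cast hn
  obtain ⟨z, hz⟩ := exists_ne xs
  have hpos : 0 < ‖z - xs‖ := norm_pos_iff.2 (sub_ne_zero.2 hz)
  have h1 := sum_gradient_strongly_monotone hn hsmooth hconv hxs z
  have h2 : ‖∑ i, gradient (f i) z‖ ≤ n * (L * ‖z - xs‖) := by
    have : ∑ i, gradient (f i) z = ∑ i, (gradient (f i) z - gradient (f i) xs) := by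
      rw [Finset.sum_sub_distrib, sum_gradient_eq_zero hn hsmooth hxs, sub_zero]
    rw [this]
    refine (norm_sum_le_of_le _ fun i _ => hsmooth.lipschitz i z xs).trans (le_of_eq ?_)
    simp
  have h3 := real_inner_le_norm (∑ i, gradient (f i) z) (z - xs)
  have h4 := mul_le_mul_of_nonneg_right h2 hpos.le
  have h5 : μ * (n * ‖z - xs‖ ^ 2) ≤ L * (n * ‖z - xs‖ ^ 2) := by linarith
  exact le_of_mul_le_mul_right h5 (by positivity)

end Objective

lemma one_le_of_isTreeDepth {B n d : ℕ} (hn : 2 ≤ n) (h : BTPP.IsTreeDepth B n d) : 1 ≤ d := by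
  rcases d with _ | d
  · have := h.2
    simp at this
    omega
  · omega

/-! ### The stepsize and the terms of the bound -/

section Bounds

variable {σ L μ : ℝ} {n d T : ℕ}

lemma log_horizon_pos (hn : 2 ≤ n) : 0 < Real.log (n * (T + 1) ^ 2) := by
  refine Real.log_pos ?_
  have h1 : (2 : ℝ) ≤ n := by exact_mod_cast hn
  have h2 : (1 : ℝ) ≤ (T + 1) ^ 2 := one_le_pow₀ (by linarith [Nat.cast_nonneg (α := ℝ) T])
  nlinarith

lemma stepsize_pos (hL : 0 < L) (hμ : 0 < μ) (hn : 2 ≤ n) (hd : 1 ≤ d) :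
    0 < BTPP.stepsize L μ n d T := by
  have h1 : (0 : ℝ) < n := by positivity
  have h2 : (0 : ℝ) < d := by exact_mod_cast hd
  have h3 := log_horizon_pos (T := T) hn
  refine lt_min ?_ ?_ <;> positivity

lemma stepsize_le (hL : 0 < L) (hμ : 0 < μ) (hn : 2 ≤ n) (hd : 1 ≤ d) :
    100 * n * d ^ 2 * L ^ 2 * BTPP.stepsize L μ n d T ≤ μ := by
  have h1 : (0 : ℝ) < n := by positivity
  have h2 : (0 : ℝ) < d := by exact_mod_cast hd
  calc 100 * n * d ^ 2 * L ^ 2 * BTPP.stepsize L μ n d T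
      ≤ 100 * n * d ^ 2 * L ^ 2 * (1 / (100 * n * d ^ 2 * (L / μ) * L)) := by
        gcongr; exact min_le_left _ _
    _ = μ := by field_simp

/-- The first branch of the minimum gives the exponential exactly. The second gives exponent
log(n(T+1)²) · 2T/(T+1), and 2T ≥ T + 1. -/
lemma exp_stepsize_le (hL : 0 < L) (hμ : 0 < μ) (hn : 2 ≤ n) (hd : 1 ≤ d) (hT : 2 * d ≤ T) :
    Real.exp (-(BTPP.stepsize L μ n d T * n * μ * T / 8)) ≤ BTPP.initialFactor L μ n d T := by
  have h1 : (0 : ℝ) < n := by positivity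
  have h2 : (0 : ℝ) < d := by exact_mod_cast hd
  have hT1 : (1 : ℝ) ≤ T := by exact_mod_cast (by omega : 1 ≤ T)
  have h3 := log_horizon_pos (T := T) hn
  unfold BTPP.initialFactor
  rcases min_choice (1 / (100 * n * d ^ 2 * (L / μ) * L))
    (16 * Real.log (n * (T + 1) ^ 2) / (n * (T + 1) * μ)) with h | h
  · refine le_max_of_le_left (le_of_eq ?_)
    rw [BTPP.stepsize, h]
    congr 2
    field_simp
    norm_num
  · refine le_max_of_le_right ?_
    rw [BTPP.stepsize, h]
    have e : 16 * Real.log (n * (T + 1) ^ 2) / (n * (T + 1) * μ) * n * μ * T / 8 =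
        Real.log (n * (T + 1) ^ 2) * (2 * T / (T + 1)) := by
      field_simp
      norm_num
    have h4 : 1 ≤ 2 * (T : ℝ) / (T + 1) := by
      rw [le_div_iff₀ (by linarith)]; linarith
    rw [e]
    calc Real.exp (-(Real.log (n * (T + 1) ^ 2) * (2 * T / (T + 1))))
        ≤ Real.exp (-Real.log (n * (T + 1) ^ 2)) := by
          rw [Real.exp_le_exp, neg_le_neg_iff]
          exact le_mul_of_one_le_right h3.le h4
      _ = 1 / (n * (T + 1) ^ 2) := by
          rw [Real.exp_neg, Real.exp_log (by positivity), one_div]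
      _ ≤ 40 / (n * (T + 1) ^ 2) := by gcongr; norm_num

lemma leadingTerm_nonneg (hn : 2 ≤ n) : 0 ≤ BTPP.leadingTerm σ μ n T := by
  have := log_horizon_pos (T := T) hn
  unfold BTPP.leadingTerm
  positivity

lemma higherOrderTerm_nonneg : 0 ≤ BTPP.higherOrderTerm σ L μ n d T := by
  unfold BTPP.higherOrderTerm
  positivity

lemma stepsize_mul_le_leadingTerm (hμ : 0 < μ) (hn : 2 ≤ n) :
    3 * BTPP.stepsize L μ n d T * σ ^ 2 / μ ≤ BTPP.leadingTerm σ μ n T := by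
  have h1 : (0 : ℝ) < n := by positivity
  have h3 := log_horizon_pos (T := T) hn
  unfold BTPP.leadingTerm
  calc 3 * BTPP.stepsize L μ n d T * σ ^ 2 / μ
      ≤ 3 * (16 * Real.log (n * (T + 1) ^ 2) / (n * (T + 1) * μ)) * σ ^ 2 / μ := by
        gcongr; exact min_le_right _ _
    _ = 48 * σ ^ 2 * Real.log (n * (T + 1) ^ 2) / (n * (T + 1) * μ ^ 2) := by
        field_simp; ring
    _ ≤ _ := by gcongr; norm_num

end Bounds

/-! ### The transient time -/

lemma half_le_log {n : ℕ} (hn : 2 ≤ n) : 1 / 2 ≤ Real.log n := by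
  have h1 : Real.log 2 ≤ Real.log n := Real.log_le_log (by norm_num) (by exact_mod_cast hn)
  linarith [Real.log_two_gt_d9]

/-- A tree of depth `d` has at least 2^d nodes, and log 2 > 2/3. -/
lemma depth_le_log {B n d : ℕ} (hB : 2 ≤ B) (h : BTPP.IsTreeDepth B n d) :
    (d : ℝ) ≤ 3 / 2 * Real.log n := by
  have h1 : ∑ k ∈ Finset.range d, 2 ^ k ≤ ∑ k ∈ Finset.range d, B ^ k :=
    Finset.sum_le_sum fun k _ => Nat.pow_le_pow_left hB k
  have h2 : 2 ^ d ≤ n := by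
    have := Nat.geomSum_eq (le_refl 2) d
    have h3 := h.1
    simp only [Nat.add_one_sub_one, Nat.div_one] at this
    have h4 : 1 ≤ 2 ^ d := Nat.one_le_two_pow
    omega
  have h3 : (2 : ℝ) ^ d ≤ n := by exact_mod_cast h2
  have h4 := Real.log_le_log (by positivity) h3
  rw [Real.log_pow] at h4
  have := Real.log_two_gt_d9
  have hd : (0 : ℝ) ≤ d := Nat.cast_nonneg d
  nlinarith

lemma pow_le_mul_pow_twelve {l : ℝ} (hl : 1 / 2 ≤ l) {m : ℕ} (hm : m ≤ 12) :
    l ^ m ≤ 4096 * l ^ 12 := by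
  calc l ^ m ≤ (2 * l) ^ m := by gcongr; linarith
    _ ≤ (2 * l) ^ 12 := pow_le_pow_right₀ (by linarith) hm
    _ = 4096 * l ^ 12 := by ring

lemma log_le_two_mul_sqrt {τ : ℝ} (hτ : 0 < τ) : Real.log τ ≤ 2 * √τ := by
  have h1 := Real.log_le_sub_one_of_pos (Real.sqrt_pos.2 hτ)
  rw [Real.log_sqrt hτ.le] at h1
  linarith

lemma mul_sqrt_le {τ b : ℝ} (hτ : 0 ≤ τ) (hb : b ^ 2 ≤ τ) : b * √τ ≤ τ := by
  calc b * √τ ≤ √τ * √τ := by gcongr; exact Real.le_sqrt_of_sq_le hb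
    _ = τ := Real.mul_self_sqrt hτ

section Transient

variable {σ L μ V : ℝ} {n d T : ℕ}

/-- The claim amounts to 24000 d⁶ κ² log(n(T+1)²) ≤ T + 1. The logarithm is at most log n + 4√(T+1),
and `h1`, `h2` give each summand half of the room. -/
lemma higherOrderTerm_le_half (hμ : 0 < μ) (hn : 2 ≤ n) {Q : ℝ}
    (hQ : 24000 * d ^ 6 * (L / μ) ^ 2 ≤ Q) (h1 : 2 * (Q * Real.log n) ≤ T)
    (h2 : (8 * Q) ^ 2 ≤ T) :
    BTPP.higherOrderTerm σ L μ n d T ≤ BTPP.leadingTerm σ μ n T / 2 := by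
  have hn' : (0 : ℝ) < n := by positivity
  have hτ : (0 : ℝ) < T + 1 := by positivity
  have hΛ := log_horizon_pos (T := T) hn
  have hQ0 : 0 ≤ Q := le_trans (by positivity) hQ
  have hlog : Real.log (n * (T + 1) ^ 2) ≤ Real.log n + 4 * √((T : ℝ) + 1) := by
    rw [Real.log_mul hn'.ne' (by positivity), Real.log_pow]
    have := log_le_two_mul_sqrt hτ
    push_cast
    linarith
  have hs := mul_sqrt_le (b := 8 * Q) hτ.le (by linarith)
  have hkey : 24000 * d ^ 6 * (L / μ) ^ 2 * Real.log (n * (T + 1) ^ 2) ≤ T + 1 := by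
    calc 24000 * d ^ 6 * (L / μ) ^ 2 * Real.log (n * (T + 1) ^ 2)
        ≤ Q * (Real.log n + 4 * √((T : ℝ) + 1)) := by gcongr
      _ ≤ T + 1 := by linarith
  unfold BTPP.higherOrderTerm BTPP.leadingTerm
  calc 26880000 * d ^ 6 * (L / μ) ^ 2 * σ ^ 2 * Real.log (n * (T + 1) ^ 2) ^ 2
        / (n * (T + 1) ^ 2 * μ ^ 2)
      = 24000 * d ^ 6 * (L / μ) ^ 2 * Real.log (n * (T + 1) ^ 2) *
        (1120 * σ ^ 2 * Real.log (n * (T + 1) ^ 2) / (n * (T + 1) ^ 2 * μ ^ 2)) := by ring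
    _ ≤ (T + 1) * (1120 * σ ^ 2 * Real.log (n * (T + 1) ^ 2) / (n * (T + 1) ^ 2 * μ ^ 2)) := by
        gcongr
    _ = _ := by field_simp; ring

/-- As the logarithm is at least 1/2, half the leading term is at least c(V+1)/(n(T+1)); `V + 1`
keeps `c` defined at V = 0. For the exponential, take logarithms: log n, 2√(T+1) and 1/c each get a
third of the room, and T + 1 ≤ 2T turns 800 into 1600. -/
lemma initialFactor_mul_le_half (hσ : 0 < σ) (hL : 0 < L) (hμ : 0 < μ) (hV : 0 ≤ V) (hn : 2 ≤ n)
    (hd : 1 ≤ d) (hT : 1 ≤ T) {c R : ℝ} (hc : c = 560 * σ ^ 2 / (μ ^ 2 * (V + 1)))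
    (hR : 1600 * d ^ 2 * (L / μ) ^ 2 ≤ R) (h0 : 40 / c ≤ T)
    (h1 : 3 * (R * Real.log n) ≤ T) (h2 : (6 * R) ^ 2 ≤ T) (h3 : 3 * (R / c) ≤ T) :
    BTPP.initialFactor L μ n d T * V ≤ BTPP.leadingTerm σ μ n T / 2 := by
  have hn' : (0 : ℝ) < n := by positivity
  have hd' : (0 : ℝ) < d := by exact_mod_cast hd
  have hT' : (1 : ℝ) ≤ T := by exact_mod_cast hT
  have hτ : (0 : ℝ) < T + 1 := by positivity
  have hc0 : 0 < c := by rw [hc]; positivity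
  have hΛ : 1 / 2 ≤ Real.log (n * (T + 1) ^ 2) := by
    refine (half_le_log hn).trans (Real.log_le_log hn' ?_)
    exact le_mul_of_one_le_right hn'.le (one_le_pow₀ (by linarith))
  have hlead : c * (V + 1) / (n * (T + 1)) ≤ BTPP.leadingTerm σ μ n T / 2 := by
    unfold BTPP.leadingTerm
    have e : c * (V + 1) = 560 * σ ^ 2 / μ ^ 2 := by rw [hc]; field_simp
    rw [e]
    calc 560 * σ ^ 2 / μ ^ 2 / (n * (T + 1))
        = 2240 * σ ^ 2 * (1 / 2) / (n * (T + 1) * μ ^ 2) / 2 := by field_simp; norm_num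
      _ ≤ _ := by gcongr
  refine le_trans ?_ hlead
  have hfac : BTPP.initialFactor L μ n d T ≤ c / (n * (T + 1)) := by
    unfold BTPP.initialFactor
    refine max_le ?_ ?_
    · have hs := mul_sqrt_le (b := 6 * R) hτ.le (by linarith)
      have hR0 : 0 < R := lt_of_lt_of_le (by positivity) hR
      have hY : Real.log n + 2 * √((T : ℝ) + 1) + 1 / c ≤ T / (800 * d ^ 2 * (L / μ) ^ 2) := by
        calc Real.log n + 2 * √((T : ℝ) + 1) + 1 / c ≤ (T + 1) / R := by
              rw [le_div_iff₀ hR0]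
              have : (Real.log n + 2 * √((T : ℝ) + 1) + 1 / c) * R =
                R * Real.log n + 6 * R * √((T : ℝ) + 1) / 3 + R / c := by ring
              rw [this]
              linarith
          _ ≤ (2 * T) / (1600 * d ^ 2 * (L / μ) ^ 2) := by gcongr; linarith
          _ = _ := by field_simp; norm_num
      have hlogc : -Real.log c ≤ 1 / c := by
        rw [← Real.log_inv, ← one_div]
        have := Real.log_le_sub_one_of_pos (show 0 < 1 / c by positivity)
        linarith
      have hlogτ := log_le_two_mul_sqrt hτ
      rw [← Real.exp_log (show 0 < c / (n * (T + 1)) by positivity), Real.exp_le_exp,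
        Real.log_div hc0.ne' (by positivity), Real.log_mul hn'.ne' hτ.ne']
      linarith
    · have : 40 ≤ c * (T + 1) := by
        rw [div_le_iff₀ hc0] at h0
        linarith
      calc 40 / (n * ((T : ℝ) + 1) ^ 2) ≤ c * (T + 1) / (n * (T + 1) ^ 2) := by gcongr
        _ = c / (n * (T + 1)) := by field_simp
  calc BTPP.initialFactor L μ n d T * V ≤ c / (n * (T + 1)) * (V + 1) := by
        gcongr; linarith
    _ = _ := by ring

end Transient

/-- The transient time of B-ary Tree Push-Pull is polylogarithmic in the number of agents. -/
theorem transient_time {σ L μ V : ℝ} (hσ : 0 < σ) (hL : 0 < L) (hμ : 0 < μ) (hV : 0 ≤ V) :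
    ∃ (K : ℝ) (q : ℕ), ∀ n B d T : ℕ, 2 ≤ n → 2 ≤ B →
      BTPP.IsTreeDepth B n d → K * Real.log n ^ q ≤ T →
        2 * d ≤ T ∧
        BTPP.higherOrderTerm σ L μ n d T + BTPP.initialFactor L μ n d T * V ≤
          BTPP.leadingTerm σ μ n T := by
  obtain ⟨c, hc⟩ : ∃ c, c = 560 * σ ^ 2 / (μ ^ 2 * (V + 1)) := ⟨_, rfl⟩
  have hc0 : 0 < c := by rw [hc]; positivity
  -- From d ≤ (3/2) log n: (3/2)⁶ ≤ 12, and 1600 (3/2)² = 3600.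
  obtain ⟨C₀, hC₀⟩ : ∃ C, C = 24000 * 12 * (L / μ) ^ 2 := ⟨_, rfl⟩
  obtain ⟨C₁, hC₁⟩ : ∃ C, C = 3600 * (L / μ) ^ 2 := ⟨_, rfl⟩
  have hC₀' : 0 ≤ C₀ := by rw [hC₀]; positivity
  have hC₁' : 0 ≤ C₁ := by rw [hC₁]; positivity
  have hc' : 0 ≤ 40 / c := by positivity
  have hc'' : 0 ≤ 3 * C₁ / c := by positivity
  -- The sum collects the coefficients of `b1` to `b7`. The exponent 12 comes from the square of d⁶,
  -- and 4096 = 2¹² lifts lower powers, since 2 log n ≥ 1.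
  refine ⟨4096 * (3 + 2 * C₀ + 64 * C₀ ^ 2 + 40 / c + 3 * C₁ + 36 * C₁ ^ 2 + 3 * C₁ / c), 12, ?_⟩
  intro n B d T hn hB hd hK
  have hl := half_le_log hn
  have hdl := depth_le_log hB hd
  have hd1 := one_le_of_isTreeDepth hn hd
  set l := Real.log n with hl_def
  have hbig : ∀ (C : ℝ) (m : ℕ), m ≤ 12 → 0 ≤ C →
      C ≤ 3 + 2 * C₀ + 64 * C₀ ^ 2 + 40 / c + 3 * C₁ + 36 * C₁ ^ 2 + 3 * C₁ / c →
      C * l ^ m ≤ T := by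
    intro C m hm hC hC'
    refine le_trans ?_ hK
    calc C * l ^ m ≤ C * (4096 * l ^ 12) := by gcongr; exact pow_le_mul_pow_twelve hl hm
      _ ≤ (3 + 2 * C₀ + 64 * C₀ ^ 2 + 40 / c + 3 * C₁ + 36 * C₁ ^ 2 + 3 * C₁ / c)
          * (4096 * l ^ 12) := by gcongr
      _ = _ := by ring
  have hsq₀ : 0 ≤ C₀ ^ 2 := sq_nonneg _
  have hsq₁ : 0 ≤ C₁ ^ 2 := sq_nonneg _
  have b1 := hbig 3 1 (by norm_num) (by norm_num) (by linarith)
  have b2 := hbig (2 * C₀) 7 (by norm_num) (by linarith) (by linarith)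
  have b3 := hbig (64 * C₀ ^ 2) 12 (by norm_num) (by linarith) (by linarith)
  have b4 := hbig (40 / c) 0 (by norm_num) (by linarith) (by linarith)
  have b5 := hbig (3 * C₁) 3 (by norm_num) (by linarith) (by linarith)
  have b6 := hbig (36 * C₁ ^ 2) 4 (by norm_num) (by linarith) (by linarith)
  have b7 := hbig (3 * C₁ / c) 2 (by norm_num) (by linarith) (by linarith)
  rw [pow_one] at b1
  rw [pow_zero, mul_one] at b4
  have hT : 2 * d ≤ T := by
    have : 2 * (d : ℝ) ≤ T := by linarith
    exact_mod_cast this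
  refine ⟨hT, ?_⟩
  have hQ : 24000 * d ^ 6 * (L / μ) ^ 2 ≤ C₀ * l ^ 6 := by
    calc 24000 * (d : ℝ) ^ 6 * (L / μ) ^ 2 ≤ 24000 * (3 / 2 * l) ^ 6 * (L / μ) ^ 2 := by gcongr
      _ = 24000 * (729 / 64) * (L / μ) ^ 2 * l ^ 6 := by ring
      _ ≤ _ := by rw [hC₀]; gcongr; norm_num
  have hR : 1600 * d ^ 2 * (L / μ) ^ 2 ≤ C₁ * l ^ 2 := by
    calc 1600 * (d : ℝ) ^ 2 * (L / μ) ^ 2 ≤ 1600 * (3 / 2 * l) ^ 2 * (L / μ) ^ 2 := by gcongr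
      _ = C₁ * l ^ 2 := by rw [hC₁]; ring
  have h1 := higherOrderTerm_le_half (σ := σ) (T := T) hμ hn hQ (by linarith) (by linarith)
  have h2 := initialFactor_mul_le_half (T := T) hσ hL hμ hV hn hd1 (by omega) hc hR b4
    (by linarith) (by linarith) (by
      calc 3 * (C₁ * l ^ 2 / c) = 3 * C₁ / c * l ^ 2 := by ring
        _ ≤ (T : ℝ) := b7)
  linarith

end

theorem theorem2 {p n : ℕ} (hn : 2 ≤ n) (B d T : ℕ) (hB : 2 ≤ B)
    (hd : BTPP.IsTreeDepth B n d) (hT : 2 * d ≤ T)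
    {S : Fin n → Type*} [∀ i, MeasurableSpace (S i)]
    (D : (i : Fin n) → Measure (S i)) [∀ i, IsProbabilityMeasure (D i)]
    {Ω : Type*} [MeasurableSpace Ω] (P : Measure Ω) [IsProbabilityMeasure P]
    (f : Fin n → BTPP.Vec p → ℝ) (g : (i : Fin n) → BTPP.Vec p → S i → BTPP.Vec p)
    (ξ : ℕ → (i : Fin n) → Ω → S i)
    (σ L μ : ℝ) (hσ : 0 < σ) (hL : 0 < L) (hμ : 0 < μ)
    (hvar : BTPP.UnbiasedBoundedVariance f g D σ)
    (hξ : BTPP.IndependentSampling P D ξ)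
    (hsmooth : BTPP.SmoothBelow f L)
    (hconv : BTPP.GradStronglyConvex (BTPP.avgObjective f) μ)
    (xstar : BTPP.Vec p) (hxstar : IsMinOn (BTPP.avgObjective f) Set.univ xstar)
    (x0 : BTPP.Vec p)
    (x₁ : Ω → BTPP.Vec p)
    (hx₁ : ∀ ω, x₁ ω = BTPP.agentIterate B (BTPP.stepsize L μ n d T) g x0
      (fun t i => ξ t i ω) T ⟨0, by omega⟩) :
    -- the convergence bound for the output of the root agent
    (Integrable (fun ω => ‖x₁ ω - xstar‖ ^ 2) P ∧
      ∫ ω, ‖x₁ ω - xstar‖ ^ 2 ∂P ≤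
        BTPP.leadingTerm σ μ n T + BTPP.higherOrderTerm σ L μ n d T
          + BTPP.initialFactor L μ n d T *
            (‖x0 - xstar‖ ^ 2 + 1 / (n * L ^ 2) * BTPP.gradFrobeniusSq f (fun _ => x0))) ∧
    -- the transient time is polylogarithmic in the number of agents
    (∀ V : ℝ, 0 ≤ V → ∃ (K : ℝ) (q : ℕ), ∀ n' B' d' T' : ℕ, 2 ≤ n' → 2 ≤ B' →
      BTPP.IsTreeDepth B' n' d' → K * Real.log n' ^ q ≤ T' →
        2 * d' ≤ T' ∧
        BTPP.higherOrderTerm σ L μ n' d' T' + BTPP.initialFactor L μ n' d' T' * V ≤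
          BTPP.leadingTerm σ μ n' T') := by
  refine ⟨?_, fun V hV => transient_time hσ hL hμ hV⟩
  have hn0 : 0 < n := by omega
  have hd1 := one_le_of_isTreeDepth hn hd
  have hlead : 0 ≤ BTPP.leadingTerm σ μ n T := leadingTerm_nonneg hn
  have hhigh : 0 ≤ BTPP.higherOrderTerm σ L μ n d T := higherOrderTerm_nonneg
  have hfac : 0 ≤ BTPP.initialFactor L μ n d T := le_max_of_le_left (Real.exp_nonneg _)
  have hQ : 0 ≤ BTPP.gradFrobeniusSq f (fun _ => x0) := Finset.sum_nonneg fun i _ => sq_nonneg _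
  have hbr : 0 ≤ ‖x0 - xstar‖ ^ 2 + 1 / (n * L ^ 2) * BTPP.gradFrobeniusSq f (fun _ => x0) := by
    positivity
  -- For p = 0 the inequality μ ≤ L may fail, but then the error is zero.
  rcases subsingleton_or_nontrivial (BTPP.Vec p) with hsub | hnt
  · have hzero : ∀ ω, ‖x₁ ω - xstar‖ ^ 2 = 0 := fun ω => by
      rw [Subsingleton.elim (x₁ ω) xstar]; simp
    simp only [hzero, integral_zero]
    exact ⟨integrable_zero _ _ _, by positivity⟩
  · have hmain := (iterates_stochasticPushPull (by omega : 0 < B) hn0 (BTPP.stepsize L μ n d T) g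
      x0 ξ).root_mean_sq_error hvar hξ hsmooth
      (fun i => heapDepth_le d i (i.isLt.trans_le hd.2))
      (sum_gradient_eq_zero hn0 hsmooth hxstar)
      (sum_gradient_strongly_monotone hn0 hsmooth hconv hxstar) hd1
      (stepsize_pos hL hμ hn hd1) hμ (strong_convexity_le_smoothness hn0 hsmooth hconv hxstar)
      hσ.le (stepsize_le hL hμ hn hd1) hT
    have hx : ∀ ω, x₁ ω = (BTPP.iterates B (BTPP.stepsize L μ n d T) g x0
        (fun t i => ξ t i ω) T).1 (heapTree B n hn0).root := hx₁
    simp only [hx]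
    refine ⟨hmain.1, hmain.2.trans ?_⟩
    have h1 := mul_le_mul_of_nonneg_right (exp_stepsize_le hL hμ hn hd1 hT) hbr
    have h2 := stepsize_mul_le_leadingTerm (σ := σ) (L := L) (d := d) (T := T) hμ hn
    linarith
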